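/- **Setting.** Variables $x,y,\dots$ range over an infinite set, symbols $a,b,\dots$ over an arbitrary set. *Terms* are $t,u ::= x\mid a\mid \lambda x.t\mid tu\mid t[x{\leftarrow}u]$ modulo $\alpha$ ($x$ is bound in $t$ by $[x{\leftarrow}u]$). The *unfolding* $t{\downarrow}$ executes all explicit substitutions: $(t[x{\leftarrow}u]){\downarrow}=t{\downarrow}\{x{\leftarrow}u{\downarrow}\}$, and it commutes with the other constructors. *Initial terms* are closed terms without explicit substitutions (closed $\lambda$-terms). *Fireballs* are $f::=\lambda x.t\mid A$ with *inerts* $A::=a\mid Af$; *values* are abstractions. *Shallow contexts* are $S::=\langle\cdot\rangle\mid tS\mid St\mid S[x{\leftarrow}t]$; *substitution contexts* are $L::=\langle\cdot\rangle\mid L[x{\leftarrow}t]$; plugging $S\langle t\rangle$ may capture variables. The *relative unfolding* is $t{\downarrow}_{\langle\cdot\rangle}=t{\downarrow}$, $t{\downarrow}_{uS}=t{\downarrow}_{Su}=t{\downarrow}_S$, $t{\downarrow}_{S[x\leftarrow u]}=t{\downarrow}_S\{x{\leftarrow}u{\downarrow}\}$. *Evaluable* contexts are defined inductively: $\langle\cdot\rangle$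 is evaluable; $tS$ is if $S$ is; $St$ is if $S$ is and $t{\downarrow}$ is a fireball; $S[x{\leftarrow}t]$ is if $S\{x{\leftarrow}t{\downarrow}\}$ is and $t{\downarrow}$ is a fireball. A context is *useful* if it is evaluable and *applicative*, i.e. of the form $S'\langle L\,u\rangle$ (with the hole in $L$). **Useful Fireball Calculus.** $\multimap_{uf}$ is the union of - $S\langle L\langle\lambda x.t\rangle u\rangle\multimap_{um}S\langle L\langle t[x{\leftarrow}u]\rangle\rangle$ if $S\langle L\,u\rangle$ is useful; - $S\langle S'\langle x\rangle[x{\leftarrow}L\langle u\rangle]\rangle\multimap_{ue}S\langle L\langle S'\langle u\rangle[x{\leftarrow}u]\rangle\rangle$ if $S\langle S'[x{\leftarrow}L\langle u\rangle]\rangle$ is useful, $u$ is not an explicit substitution, and $u{\downarrow}_{S\langle L\rangle}$ is a value. *Structural equivalence* $\equiv$ is the least equivalence relation closed by weak contexts $W::=\langle\cdot\rangle\mid tW\mid Wt\mid W[x{\leftarrow}t]\mid t[x{\leftarrow}W]$ and containing $t[x{\leftarrow}u][y{\leftarrow}w]\sim t[y{\leftarrow}w][x{\leftarrow}u]$ ($y\notin\mathrm{fv}(u)$,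 $x\notin\mathrm{fv}(w)$); $(tw)[x{\leftarrow}u]\sim t(w[x{\leftarrow}u])$ ($x\notin\mathrm{fv}(t)$); $(tw)[x{\leftarrow}u]\sim t[x{\leftarrow}u]\,w$ ($x\notin\mathrm{fv}(w)$); $t[x{\leftarrow}u][y{\leftarrow}w]\sim t[x{\leftarrow}u[y{\leftarrow}w]]$ ($y\notin\mathrm{fv}(t)$). **The GLAMoUr machine.** *Codes* $t,u,w$ are terms without explicit substitutions, not considered modulo $\alpha$. Labels are $l::=v\mid A$ (value, inert). Items are $\phi::=t\mid(t,\pi)$, stacks $\pi::=\varepsilon\mid\phi^l:\pi$, environments $E::=\varepsilon\mid[x{\leftarrow}\phi^l]:E$, dumps $D::=\varepsilon\mid D:(t,\pi)$. A state is a quadruple $(D,t,\pi,E)$ in which all bound variables are distinct (it is *well-named*; environment entries and abstractions bind). It is *initial* if it is $(\varepsilon,t,\varepsilon,\varepsilon)$ with $t$ closed; *reachable* states are those reached from initial ones. The transitions are - $c_1$: $(D,tu,\pi,E)\to(D:(t,\pi),u,\varepsilon,E)$ - $um$: $(D,\lambda x.t,\phi^l:\pi,E)\to(D,t,\pi,[x{\leftarrow}\phi^l]:E)$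 - $c_2$: $(D:(t,\pi),\lambda x.u,\varepsilon,E)\to(D,t,(\lambda x.u)^v:\pi,E)$ - $c_3$: $(D:(t,\pi),a,\pi',E)\to(D,t,(a,\pi')^A:\pi,E)$ - $c_4$: $(D:(t,\pi),x,\pi',E)\to(D,t,(x,\pi')^A:\pi,E)$ if $E=E_1[x{\leftarrow}\phi^A]E_2$ - $c_5$: $(D:(t,\pi),x,\varepsilon,E)\to(D,t,x^v:\pi,E)$ if $E=E_1[x{\leftarrow}u^v]E_2$ - $ue$: $(D,x,\phi^l:\pi,E)\to(D,u',\phi^l:\pi,E)$ if $E=E_1[x{\leftarrow}u^v]E_2$, where $u'$ is any code $\alpha$-equivalent to $u$ such that the resulting state is well-named. $um$ is multiplicative, $ue$ is exponential (both are *principal*), and $c_1,\dots,c_5$ are *commutative*. *Decoding* (written with an underline, labels ignored): $\underline{\varepsilon}=\langle\cdot\rangle$, $\underline{\phi^l:\pi}=\underline\pi\langle\langle\cdot\rangle\underline\phi\rangle$, $\underline{(t,\pi)}=\underline\pi\langle t\rangle$ for items, $\underline{D:(t,\pi)}=\underline D\langle\underline\pi\langle t\langle\cdot\rangle\rangle\rangle$,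 $\underline{[x{\leftarrow}\phi^l]:E}=\underline E\langle\langle\cdot\rangle[x{\leftarrow}\underline\phi]\rangle$; for $s=(D,t,\pi,E)$, $S_s=\underline E\langle\underline D\langle\underline\pi\rangle\rangle$ and $\underline s=S_s\langle t\rangle$. **Theorem.** $(\text{GLAMoUr},\multimap_{uf},\equiv,\underline{\,\cdot\,})$ is a reflective explicit distillery. That is: 1. *Machine.* From each state there is at most one transition, up to the choice of the bound names of the code $u'$ in $ue$. The decoding is a bijection between initial states, up to $\alpha$, and closed $\lambda$-terms. 2. *Strategy.* $\multimap_{uf}$ is deterministic, including the kind ($um$ or $ue$) of the step. 3. *Strong bisimulation.* $\equiv$ is an equivalence relation, and for every term $t$ obtained from an initial term by steps of $\multimap_{uf}$ and $\equiv$, and for $k\in\{um,ue\}$: if $t\equiv u$ and $t\multimap_k t'$ then there is $u'$ with $u\multimap_k u'$ and $t'\equiv u'$. 4. *Distillation.* For $s$ reachable, a principal transition $s\to s'$ implies $\underline s\multimap_{uf}\equiv\underline{s'}$, and a commutative one implies $\underline s\equiv\underline{s'}$. 5. *Reflective.* From a reachable state there is no infinite sequence of commutative transitions; and if $s$ is reachable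 and $\underline s$ is not $\multimap_{uf}$-normal, then some transition applies to $s$. 6. *Explicit.* For $s$ reachable, $s\to_{um}s'$ implies $\underline s\multimap_{um}\equiv\underline{s'}$, and $s\to_{ue}s'$ implies $\underline s\multimap_{ue}\equiv\underline{s'}$. In particular, for every reachable state $s$: if $s\to_{c_i}s'$ with $1\le i\le 5$ then $\underline s=\underline{s'}$; if $s\to_{um}s'$ then $\underline s\multimap_{um}\equiv\underline{s'}$; if $s\to_{ue}s'$ then $\underline s\multimap_{ue}\underline{s'}$. Moreover usefulness is tested locally by the labels: if $s=(D,x,\pi,E_1[x{\leftarrow}\phi^l]E_2)$ is reachable, then [$S_s$ is useful and $\underline\phi{\downarrow}_{\underline{E_2}}$ is a value] if and only if [$l=v$ and $\pi\neq\varepsilon$]. -/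

import Mathlib

universe u

namespace Glamour

/-! ## Terms with explicit substitutions, modulo alpha -/

/-- Terms `t, u ::= x | a | λx.t | t u | t[x←u]` modulo α-equivalence, in de Bruijn style:
`lam t` binds index `0` in `t`, and `es t u` stands for `t[x←u]` and binds index `0` in `t`
(but not in `u`). -/
inductive Term (Sym : Type u) : Type u
  | var (i : ℕ)
  | sym (a : Sym)
  | lam (t : Term Sym)
  | app (t w : Term Sym)
  | es (t w : Term Sym)

/-- Extension of a renaming under one binder. -/
def upr (ρ : ℕ → ℕ) : ℕ → ℕ
  | 0 => 0
  | n + 1 => ρ n + 1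

/-- The renaming exchanging the two innermost variables. -/
def swap01 : ℕ → ℕ
  | 0 => 1
  | 1 => 0
  | n + 2 => n + 2

namespace Term

variable {Sym : Type u}

def rename (ρ : ℕ → ℕ) : Term Sym → Term Sym
  | var i => var (ρ i)
  | sym a => sym a
  | lam t => lam (t.rename (upr ρ))
  | app t w => app (t.rename ρ) (w.rename ρ)
  | es t w => es (t.rename (upr ρ)) (w.rename ρ)

/-- Weakening by `k` variables: the same term, seen under `k` further binders that do not bind
anything in it. -/
def shift (k : ℕ) (t : Term Sym) : Term Sym := t.rename (fun i => i + k)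

/-- Extension of a simultaneous substitution under one binder. -/
def ups (σ : ℕ → Term Sym) : ℕ → Term Sym
  | 0 => var 0
  | n + 1 => (σ n).shift 1

/-- Simultaneous capture-avoiding substitution. -/
def subst (σ : ℕ → Term Sym) : Term Sym → Term Sym
  | var i => σ i
  | sym a => sym a
  | lam t => lam (t.subst (ups σ))
  | app t w => app (t.subst σ) (w.subst σ)
  | es t w => es (t.subst (ups σ)) (w.subst σ)

/-- The substitution `{x←w}` where `x` is the variable of index `0`. -/
def single (w : Term Sym) : ℕ → Term Sym
  | 0 => w
  | n + 1 => var n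

/-- All free indices are below `k`. -/
def ClosedAt : ℕ → Term Sym → Prop
  | k, var i => i < k
  | _, sym _ => True
  | k, lam t => ClosedAt (k + 1) t
  | k, app t w => ClosedAt k t ∧ ClosedAt k w
  | k, es t w => ClosedAt (k + 1) t ∧ ClosedAt k w

/-- No explicit substitution occurs in the term, not even under an abstraction. -/
def ESFree : Term Sym → Prop
  | var _ => True
  | sym _ => True
  | lam t => t.ESFree
  | app t w => t.ESFree ∧ w.ESFree
  | es _ _ => False

/-- Initial terms: closed λ-terms (without explicit substitutions). -/
def IsInitial (t : Term Sym) : Prop := t.ClosedAt 0 ∧ t.ESFree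

/-- The unfolding of a term: all explicit substitutions are executed. -/
def unf : Term Sym → Term Sym
  | var i => var i
  | sym a => sym a
  | lam t => lam t.unf
  | app t w => app t.unf w.unf
  | es t w => t.unf.subst (single w.unf)

def IsValue (t : Term Sym) : Prop := ∃ b, t = lam b

mutual
/-- Inerts `A ::= a | A f`. -/
inductive IsInert : Term Sym → Prop
  | sym (a : Sym) : IsInert (.sym a)
  | app {A f : Term Sym} : IsInert A → IsFireball f → IsInert (.app A f)
/-- Fireballs `f ::= λx.t | A`. -/
inductive IsFireball : Term Sym → Prop
  | value (b : Term Sym) : IsFireball (.lam b)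
  | inert {A : Term Sym} : IsInert A → IsFireball A
end

end Term

/-! ## Shallow contexts -/

/-- Shallow contexts `S ::= ⟨·⟩ | t S | S t | S[x←t]`. Plugging may capture. -/
inductive Ctx (Sym : Type u) : Type u
  | hole
  | appR (t : Term Sym) (S : Ctx Sym)
  | appL (S : Ctx Sym) (t : Term Sym)
  | es (S : Ctx Sym) (t : Term Sym)

namespace Ctx

variable {Sym : Type u}

/-- The number of binders above the hole. -/
def depth : Ctx Sym → ℕ
  | hole => 0
  | appR _ S => S.depth
  | appL S _ => S.depth
  | es S _ => S.depth + 1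

/-- `S⟨t⟩`. -/
def plug : Ctx Sym → Term Sym → Term Sym
  | hole, r => r
  | appR t S, r => .app t (S.plug r)
  | appL S t, r => .app (S.plug r) t
  | es S t, r => .es (S.plug r) t

/-- `S⟨S'⟩`. -/
def comp : Ctx Sym → Ctx Sym → Ctx Sym
  | hole, S' => S'
  | appR t S, S' => appR t (S.comp S')
  | appL S t, S' => appL (S.comp S') t
  | es S t, S' => es (S.comp S') t

def rename (ρ : ℕ → ℕ) : Ctx Sym → Ctx Sym
  | hole => hole
  | appR t S => appR (t.rename ρ) (S.rename ρ)
  | appL S t => appL (S.rename ρ) (t.rename ρ)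
  | es S t => es (S.rename (upr ρ)) (t.rename ρ)

/-- Implicit substitution on contexts. -/
def subst (σ : ℕ → Term Sym) : Ctx Sym → Ctx Sym
  | hole => hole
  | appR t S => appR (t.subst σ) (S.subst σ)
  | appL S t => appL (S.subst σ) (t.subst σ)
  | es S t => es (S.subst (Term.ups σ)) (t.subst σ)

/-- Substitution contexts `L ::= ⟨·⟩ | L[x←t]`. -/
def IsSubst : Ctx Sym → Prop
  | hole => True
  | es L _ => L.IsSubst
  | _ => False

/-- The unfolding of a term relative to a shallow context. -/
def relUnf (r : Term Sym) : Ctx Sym → Term Sym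
  | hole => r.unf
  | appR _ S => relUnf r S
  | appL S _ => relUnf r S
  | es S t => (relUnf r S).subst (Term.single t.unf)

/-- Applicative contexts: those of the form `S'⟨L t⟩`. -/
def Applicative (S : Ctx Sym) : Prop :=
  ∃ (S' L : Ctx Sym) (t : Term Sym), L.IsSubst ∧ S = S'.comp (appL L t)

inductive Evaluable : Ctx Sym → Prop
  | hole : Evaluable .hole
  | appL {S : Ctx Sym} {t : Term Sym} :
      Evaluable S → t.unf.IsFireball → Evaluable (.appL S t)
  | appR {S : Ctx Sym} {t : Term Sym} : Evaluable S → Evaluable (.appR t S)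
  | es {S : Ctx Sym} {t : Term Sym} :
      Evaluable (S.subst (Term.single t.unf)) → t.unf.IsFireball → Evaluable (.es S t)

def Useful (S : Ctx Sym) : Prop := S.Evaluable ∧ S.Applicative

end Ctx

/-! ## The Useful Fireball Calculus and structural equivalence -/

/-- The two kinds of rewriting rules. -/
inductive RuleKind
  | mul
  | exp

/-- The strategy `⊸_uf`, as the union of `⊸_um` (kind `mul`) and `⊸_ue` (kind `exp`):
* `S⟨L⟨λx.t⟩ w⟩ ⊸_um S⟨L⟨t[x←w]⟩⟩` if `S⟨L w⟩` is useful;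
* `S⟨S'⟨x⟩[x←L⟨w⟩]⟩ ⊸_ue S⟨L⟨S'⟨w⟩[x←w]⟩⟩` if `S⟨S'[x←L⟨w⟩]⟩` is useful, `w` is not an explicit
  substitution, and `w` unfolds to a value relatively to `S⟨L⟩`.

The shifts and the renaming of `S'` only account for the binders under which a term is moved. -/
inductive UStep {Sym : Type u} : RuleKind → Term Sym → Term Sym → Prop
  | um (S L : Ctx Sym) (t w : Term Sym) :
      L.IsSubst → (S.comp (.appL L w)).Useful →
      UStep .mul (S.plug (.app (L.plug (.lam t)) w))
        (S.plug (L.plug (.es t (w.shift L.depth))))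
  | ue (S S' L : Ctx Sym) (w : Term Sym) :
      L.IsSubst → (S.comp (.es S' (L.plug w))).Useful →
      (∀ p q, w ≠ .es p q) → (Ctx.relUnf w (S.comp L)).IsValue →
      UStep .exp (S.plug (.es (S'.plug (.var S'.depth)) (L.plug w)))
        (S.plug (L.plug
          (.es ((S'.rename (upr (fun i => i + L.depth))).plug (w.shift (S'.depth + 1))) w)))

/-- Structural equivalence: the least equivalence relation closed by weak contexts that contains
* `t[x←w][y←r] ∼ t[y←r][x←w]` if `y ∉ fv w` and `x ∉ fv r`;
* `(t r)[x←w] ∼ t (r[x←w])` if `x ∉ fv t`;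
* `(t r)[x←w] ∼ t[x←w] r` if `x ∉ fv r`;
* `t[x←w][y←r] ∼ t[x←w[y←r]]` if `y ∉ fv t`. -/
inductive StructEq {Sym : Type u} : Term Sym → Term Sym → Prop
  | com (t w r : Term Sym) :
      StructEq (.es (.es t (w.shift 1)) r) (.es (.es (t.rename swap01) (r.shift 1)) w)
  | atR (t r w : Term Sym) : StructEq (.es (.app (t.shift 1) r) w) (.app t (.es r w))
  | atL (t r w : Term Sym) : StructEq (.es (.app t (r.shift 1)) w) (.app (.es t w) r)
  | box (t w r : Term Sym) :
      StructEq (.es (.es (t.rename (upr (fun i => i + 1))) w) r) (.es t (.es w r))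
  | refl (t : Term Sym) : StructEq t t
  | symm {t w : Term Sym} : StructEq t w → StructEq w t
  | trans {t w r : Term Sym} : StructEq t w → StructEq w r → StructEq t r
  | appL {t t' : Term Sym} (w : Term Sym) : StructEq t t' → StructEq (.app t w) (.app t' w)
  | appR {w w' : Term Sym} (t : Term Sym) : StructEq w w' → StructEq (.app t w) (.app t w')
  | esL {t t' : Term Sym} (w : Term Sym) : StructEq t t' → StructEq (.es t w) (.es t' w)
  | esR {w w' : Term Sym} (t : Term Sym) : StructEq w w' → StructEq (.es t w) (.es t w')

/-! ## The machine: codes and data structures -/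

/-- Codes: λ-terms with named variables, not considered up to α. -/
inductive Code (Sym : Type u) : Type u
  | var (x : ℕ)
  | sym (a : Sym)
  | lam (x : ℕ) (t : Code Sym)
  | app (t w : Code Sym)

namespace Code

variable {Sym : Type u}

/-- The term (modulo α) of a code in the scope of the binders `Γ`, innermost first. A name `x` not
in `Γ` becomes the `x`-th free variable. -/
def toTerm : List ℕ → Code Sym → Term Sym
  | Γ, var x => .var (if x ∈ Γ then Γ.idxOf x else Γ.length + x)
  | _, sym a => .sym a
  | Γ, lam x t => .lam (toTerm (x :: Γ) t)
  | Γ, app t w => .app (toTerm Γ t) (toTerm Γ w)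

def AlphaEq (c c' : Code Sym) : Prop := c.toTerm [] = c'.toTerm []

def binders : Code Sym → List ℕ
  | var _ => []
  | sym _ => []
  | lam x t => x :: t.binders
  | app t w => t.binders ++ w.binders

end Code

/-- Labels: `val` for "unfolds to a value", `inert` for "unfolds to an inert". -/
inductive Label
  | val
  | inert

mutual
/-- Stack items `φ ::= t | (t, π)`. -/
inductive Item (Sym : Type u) : Type u
  | code (t : Code Sym)
  | pair (t : Code Sym) (π : Stack Sym)
/-- Stacks `π ::= ε | φˡ : π`. -/
inductive Stack (Sym : Type u) : Type u
  | nil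
  | cons (φ : Item Sym) (l : Label) (π : Stack Sym)
end

/-- Global environments `E ::= ε | [x←φˡ] : E`. -/
abbrev Env (Sym : Type u) := List (ℕ × Item Sym × Label)

/-- Dumps `D ::= ε | D : (t, π)`; the head of the list is the last entry. -/
abbrev Dump (Sym : Type u) := List (Code Sym × Stack Sym)

mutual
def Item.binders {Sym : Type u} : Item Sym → List ℕ
  | .code t => t.binders
  | .pair t π => t.binders ++ π.binders
def Stack.binders {Sym : Type u} : Stack Sym → List ℕ
  | .nil => []
  | .cons φ _ π => φ.binders ++ π.binders
end

mutual
/-- Decoding of stack items in the scope of `Γ`. -/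
def Item.decode {Sym : Type u} (Γ : List ℕ) : Item Sym → Term Sym
  | .code t => t.toTerm Γ
  | .pair t π => (π.decode Γ).plug (t.toTerm Γ)
/-- Decoding of stacks in the scope of `Γ`. -/
def Stack.decode {Sym : Type u} (Γ : List ℕ) : Stack Sym → Ctx Sym
  | .nil => .hole
  | .cons φ _ π => (π.decode Γ).comp (.appL .hole (φ.decode Γ))
end

def Env.names {Sym : Type u} (E : Env Sym) : List ℕ := E.map (fun e => e.1)

def Env.decode {Sym : Type u} : Env Sym → Ctx Sym
  | [] => .hole
  | (_, φ, _) :: E => (Env.decode E).comp (.es .hole (φ.decode (Env.names E)))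

def Dump.decode {Sym : Type u} (Γ : List ℕ) : Dump Sym → Ctx Sym
  | [] => .hole
  | (t, π) :: D => (Dump.decode Γ D).comp ((π.decode Γ).comp (.appR (t.toTerm Γ) .hole))

/-- Machine configurations, not necessarily well-named. -/
structure Config (Sym : Type u) where
  dump : Dump Sym
  code : Code Sym
  stack : Stack Sym
  env : Env Sym

namespace Config

variable {Sym : Type u}

/-- The names bound in the configuration, by an abstraction or by the environment. -/
def binders (s : Config Sym) : List ℕ :=
  s.dump.flatMap (fun d => d.1.binders ++ d.2.binders) ++ s.code.binders ++ s.stack.binders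
    ++ s.env.flatMap (fun e => e.1 :: e.2.1.binders)

/-- All variables bound in the configuration are distinct. -/
def WellNamed (s : Config Sym) : Prop := s.binders.Nodup

/-- The shallow context of a configuration. -/
def ctx (s : Config Sym) : Ctx Sym :=
  (Env.decode s.env).comp
    ((Dump.decode (Env.names s.env) s.dump).comp (s.stack.decode (Env.names s.env)))

def decode (s : Config Sym) : Term Sym := s.ctx.plug (s.code.toTerm (Env.names s.env))

end Config

/-- The states of the machine are the well-named configurations. -/
def State (Sym : Type u) : Type u := {s : Config Sym // s.WellNamed}

/-- Names of the transitions. -/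
inductive Tr
  | c1 | c2 | c3 | c4 | c5 | um | ue

/-- Transitions on configurations. On states, which are well-named, the code `w'` in `ue` is any
code α-equivalent to `w` that preserves well-naming. -/
inductive Trans {Sym : Type u} : Tr → Config Sym → Config Sym → Prop
  | c1 (D : Dump Sym) (t w : Code Sym) (π : Stack Sym) (E : Env Sym) :
      Trans .c1 ⟨D, .app t w, π, E⟩ ⟨(t, π) :: D, w, .nil, E⟩
  | um (D : Dump Sym) (x : ℕ) (t : Code Sym) (φ : Item Sym) (l : Label) (π : Stack Sym)
      (E : Env Sym) :
      Trans .um ⟨D, .lam x t, .cons φ l π, E⟩ ⟨D, t, π, (x, φ, l) :: E⟩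
  | c2 (D : Dump Sym) (t : Code Sym) (π : Stack Sym) (x : ℕ) (w : Code Sym) (E : Env Sym) :
      Trans .c2 ⟨(t, π) :: D, .lam x w, .nil, E⟩ ⟨D, t, .cons (.code (.lam x w)) .val π, E⟩
  | c3 (D : Dump Sym) (t : Code Sym) (π : Stack Sym) (a : Sym) (π' : Stack Sym) (E : Env Sym) :
      Trans .c3 ⟨(t, π) :: D, .sym a, π', E⟩ ⟨D, t, .cons (.pair (.sym a) π') .inert π, E⟩
  | c4 (D : Dump Sym) (t : Code Sym) (π : Stack Sym) (x : ℕ) (π' : Stack Sym) (φ : Item Sym)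
      (E₁ E₂ : Env Sym) :
      Trans .c4 ⟨(t, π) :: D, .var x, π', E₁ ++ (x, φ, .inert) :: E₂⟩
        ⟨D, t, .cons (.pair (.var x) π') .inert π, E₁ ++ (x, φ, .inert) :: E₂⟩
  | c5 (D : Dump Sym) (t : Code Sym) (π : Stack Sym) (x : ℕ) (w : Code Sym) (E₁ E₂ : Env Sym) :
      Trans .c5 ⟨(t, π) :: D, .var x, .nil, E₁ ++ (x, .code w, .val) :: E₂⟩
        ⟨D, t, .cons (.code (.var x)) .val π, E₁ ++ (x, .code w, .val) :: E₂⟩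
  | ue (D : Dump Sym) (x : ℕ) (w w' : Code Sym) (φ : Item Sym) (l : Label) (π : Stack Sym)
      (E₁ E₂ : Env Sym) : w.AlphaEq w' →
      Trans .ue ⟨D, .var x, .cons φ l π, E₁ ++ (x, .code w, .val) :: E₂⟩
        ⟨D, w', .cons φ l π, E₁ ++ (x, .code w, .val) :: E₂⟩

namespace State

variable {Sym : Type u}

/-- Initial states `(ε, t, ε, ε)` with `t` closed (and well-named). -/
def IsInitial (s : State Sym) : Prop :=
  ∃ t : Code Sym, (t.toTerm []).ClosedAt 0 ∧ s.1 = ⟨[], t, .nil, []⟩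

/-- The two states are equal up to the bound names of their codes. -/
def Same (s s' : State Sym) : Prop :=
  s.1.dump = s'.1.dump ∧ s.1.code.AlphaEq s'.1.code ∧ s.1.stack = s'.1.stack ∧ s.1.env = s'.1.env

end State

/-! ## Distilleries -/

inductive TransKind
  | principal (k : RuleKind)
  | commutative

/-- The data of an abstract machine with two kinds of principal transitions, a strategy with two
kinds of rules, a relation on terms and a decoding. No law is assumed here. -/
structure System where
  State : Type u
  Tr : Type
  Term : Type u
  initial : State → Prop
  step : Tr → State → State → Prop
  kind : Tr → TransKind
  /-- equality of states up to the choice of bound names -/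
  same : State → State → Prop
  /-- closed λ-terms -/
  initialTerm : Term → Prop
  rule : RuleKind → Term → Term → Prop
  equiv : Term → Term → Prop
  decode : State → Term

namespace System

variable (D : System.{u})

/-- Reachable states. -/
def Reachable (s : D.State) : Prop :=
  ∃ s₀, D.initial s₀ ∧ Relation.ReflTransGen (fun p q => ∃ l, D.step l p q) s₀ s

/-- Terms obtained from closed λ-terms by steps of the strategy and by structural equivalence. -/
def TermReachable (t : D.Term) : Prop :=
  ∃ t₀, D.initialTerm t₀ ∧
    Relation.ReflTransGen (fun p q => (∃ k, D.rule k p q) ∨ D.equiv p q) t₀ t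

structure IsDistillery : Prop where
  /-- the transition system is deterministic -/
  machine_det : ∀ l₁ l₂ s s₁ s₂, D.step l₁ s s₁ → D.step l₂ s s₂ → l₁ = l₂ ∧ D.same s₁ s₂
  /-- initial states are in bijection with closed λ-terms, through the decoding -/
  initial_closed : ∀ s, D.initial s → D.initialTerm (D.decode s)
  initial_inj : ∀ s s', D.initial s → D.initial s' → D.decode s = D.decode s' → D.same s s'
  initial_surj : ∀ t, D.initialTerm t → ∃ s, D.initial s ∧ D.decode s = t
  /-- the strategy is deterministic -/
  strategy_det : ∀ k₁ k₂ t t₁ t₂, D.rule k₁ t t₁ → D.rule k₂ t t₂ → k₁ = k₂ ∧ t₁ = t₂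
  /-- structural equivalence is an equivalence relation and a strong bisimulation -/
  equiv_equivalence : Equivalence D.equiv
  bisim : ∀ k t w t', D.TermReachable t → D.equiv t w → D.rule k t t' →
    ∃ w', D.rule k w w' ∧ D.equiv t' w'
  principal : ∀ l k s s', D.Reachable s → D.kind l = .principal k → D.step l s s' →
    ∃ k' t, D.rule k' (D.decode s) t ∧ D.equiv t (D.decode s')
  commutative : ∀ l s s', D.Reachable s → D.kind l = .commutative → D.step l s s' →
    D.equiv (D.decode s) (D.decode s')

structure IsReflective : Prop where
  /-- no infinite sequence of commutative transitions starts from a reachable state -/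
  termination : ∀ s, D.Reachable s →
    ¬ ∃ f : ℕ → D.State, f 0 = s ∧
      ∀ n, ∃ l, D.kind l = .commutative ∧ D.step l (f n) (f (n + 1))
  /-- if the decoding of a reachable state reduces then the state is not final -/
  progress : ∀ s, D.Reachable s → (∃ k t, D.rule k (D.decode s) t) → ∃ l s', D.step l s s'

/-- The decoding preserves the partition of principal transitions. -/
def IsExplicit : Prop :=
  ∀ l k s s', D.Reachable s → D.kind l = .principal k → D.step l s s' →
    ∃ t, D.rule k (D.decode s) t ∧ D.equiv t (D.decode s')

end System

def Tr.kind : Tr → TransKind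
  | .um => .principal .mul
  | .ue => .principal .exp
  | _ => .commutative

/-- The quadruple (GLAMoUr, `⊸_uf`, `≡`, decoding). -/
def glamour (Sym : Type u) : System.{u} where
  State := State Sym
  Tr := Tr
  Term := Term Sym
  initial := State.IsInitial
  step l s s' := Trans l s.1 s'.1
  kind := Tr.kind
  same := State.Same
  initialTerm := Term.IsInitial
  rule := UStep
  equiv := StructEq
  decode s := s.1.decode

end Glamour

-- The strategy is given by contexts; the proof replaces it with a computation. Instead of
-- substituting into contexts, terms and contexts are read in an environment `σ` of unfolded terms:
-- `unfIn` unfolds a term, `EvalIn` is evaluability, and a boolean (`applied`) records whether the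
-- hole is applied. Then `redex σ b t` searches for the redex by structural recursion, looking into
-- the argument of an application until it unfolds to a fireball. It returns a step, an abstraction
-- waiting for an argument, or an applied variable that waits for the substitution binding it, with
-- its occurrence marked. By `uStep_iff_redex` the steps of the strategy are exactly the step
-- outcomes of this function, so determinism is immediate.
--
-- For the bisimulation, `StructEq.redex_equiv` shows that equivalent terms have equivalent
-- outcomes. This fails for arbitrary terms: in `(t r)[x←w]` a `w` that does not unfold to a
-- fireball blocks everything, while in `t (r[x←w])` it may block nothing. Hence the invariant
-- `WellFormed`, preserved by `StructEq.wellFormed_iff` and `WellFormed.uStep`: explicit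
-- substitutions outside abstractions contain terms unfolding to fireballs, and bodies of
-- abstractions have no explicit substitutions.
--
-- For the machine, the invariant `Config.OK` says that labels are right. Then the context of a
-- state is evaluable, and applicative exactly when the stack is nonempty, so usefulness is read off
-- the stack and the label. Commutative transitions only move the focus in one fixed term; `um`
-- fires the redex and then extrudes the new substitution to the environment by structural
-- equivalence; `ue` is the exponential rule on the nose. A state without transition has an empty
-- dump and decodes to a term unfolding to a fireball, hence to a normal term. Commutative
-- transitions decrease the total size of the code under evaluation and of the codes waiting in the
-- dump.

namespace Glamour

/-! ## Renaming and substitution -/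

namespace Term

variable {Sym : Type u}

/-- The substitution mapping `0` to `a` and `n + 1` to `σ n`. -/
def scons (a : Term Sym) (σ : ℕ → Term Sym) : ℕ → Term Sym
  | 0 => a
  | n + 1 => σ n

@[simp] theorem scons_zero (a : Term Sym) (σ : ℕ → Term Sym) : scons a σ 0 = a := rfl
@[simp] theorem scons_succ (a : Term Sym) (σ : ℕ → Term Sym) (n : ℕ) :
    scons a σ (n + 1) = σ n := rfl

theorem single_eq_scons (w : Term Sym) : single w = scons w var := by
  funext i; cases i <;> rfl

theorem scons_comp_upr (a : Term Sym) (σ : ℕ → Term Sym) (ρ : ℕ → ℕ) :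
    (fun i => scons a σ (upr ρ i)) = scons a (fun i => σ (ρ i)) := by
  funext i; cases i <;> rfl

theorem upr_comp (ρ ρ' : ℕ → ℕ) : (fun i => upr ρ' (upr ρ i)) = upr (fun i => ρ' (ρ i)) := by
  funext i; cases i <;> rfl

theorem upr_id : upr (fun i => i) = fun i => i := by
  funext i; cases i <;> rfl

theorem rename_rename (t : Term Sym) (ρ ρ' : ℕ → ℕ) :
    (t.rename ρ).rename ρ' = t.rename (fun i => ρ' (ρ i)) := by
  induction t generalizing ρ ρ' with
  | var i => rfl
  | sym a => rfl
  | lam t ih => simp [rename, ih, upr_comp]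
  | app t w iht ihw => simp [rename, iht, ihw]
  | es t w iht ihw => simp [rename, iht, ihw, upr_comp]

theorem ups_comp_upr (σ : ℕ → Term Sym) (ρ : ℕ → ℕ) :
    (fun i => ups σ (upr ρ i)) = ups (fun i => σ (ρ i)) := by
  funext i; cases i <;> rfl

theorem subst_rename (t : Term Sym) (ρ : ℕ → ℕ) (σ : ℕ → Term Sym) :
    (t.rename ρ).subst σ = t.subst (fun i => σ (ρ i)) := by
  induction t generalizing ρ σ with
  | var i => rfl
  | sym a => rfl
  | lam t ih => simp [rename, subst, ih, ups_comp_upr]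
  | app t w iht ihw => simp [rename, subst, iht, ihw]
  | es t w iht ihw => simp [rename, subst, iht, ihw, ups_comp_upr]

theorem rename_ups (σ : ℕ → Term Sym) (ρ : ℕ → ℕ) :
    (fun i => (ups σ i).rename (upr ρ)) = ups (fun i => (σ i).rename ρ) := by
  funext i; cases i with
  | zero => rfl
  | succ n => simp [ups, shift, rename_rename, upr]

theorem rename_subst (t : Term Sym) (σ : ℕ → Term Sym) (ρ : ℕ → ℕ) :
    (t.subst σ).rename ρ = t.subst (fun i => (σ i).rename ρ) := by
  induction t generalizing ρ σ with
  | var i => rfl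
  | sym a => rfl
  | lam t ih => simp [rename, subst, ih, rename_ups]
  | app t w iht ihw => simp [rename, subst, iht, ihw]
  | es t w iht ihw => simp [rename, subst, iht, ihw, rename_ups]

theorem subst_ups (σ τ : ℕ → Term Sym) :
    (fun i => (ups σ i).subst (ups τ)) = ups (fun i => (σ i).subst τ) := by
  funext i; cases i with
  | zero => rfl
  | succ n => simp [ups, shift, subst_rename, rename_subst]

theorem subst_subst (t : Term Sym) (σ τ : ℕ → Term Sym) :
    (t.subst σ).subst τ = t.subst (fun i => (σ i).subst τ) := by
  induction t generalizing σ τ with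
  | var i => rfl
  | sym a => rfl
  | lam t ih => simp [subst, ih, subst_ups]
  | app t w iht ihw => simp [subst, iht, ihw]
  | es t w iht ihw => simp [subst, iht, ihw, subst_ups]

theorem ups_var_comp (ρ : ℕ → ℕ) :
    ups (fun i => (var (ρ i) : Term Sym)) = fun i => var (upr ρ i) := by
  funext i; cases i <;> rfl

theorem rename_eq_subst (t : Term Sym) (ρ : ℕ → ℕ) :
    t.rename ρ = t.subst (fun i => var (ρ i)) := by
  induction t generalizing ρ with
  | var i => rfl
  | sym a => rfl
  | lam t ih => simp [rename, subst, ih, ups_var_comp]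
  | app t w iht ihw => simp [rename, subst, iht, ihw]
  | es t w iht ihw => simp [rename, subst, iht, ihw, ups_var_comp]

theorem rename_id (t : Term Sym) : t.rename (fun i => i) = t := by
  induction t with
  | var i => rfl
  | sym a => rfl
  | lam t ih => simp [rename, upr_id, ih]
  | app t w iht ihw => simp [rename, iht, ihw]
  | es t w iht ihw => simp [rename, upr_id, iht, ihw]

theorem subst_var (t : Term Sym) : t.subst var = t := by
  rw [← rename_eq_subst t fun i => i, rename_id]

theorem shift_zero (t : Term Sym) : t.shift 0 = t := rename_id t

theorem rename_shift_one (t : Term Sym) (ρ : ℕ → ℕ) :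
    (t.shift 1).rename (upr ρ) = (t.rename ρ).shift 1 := by
  simp only [shift, rename_rename]; rfl

theorem ups_scons (a : Term Sym) (σ τ : ℕ → Term Sym) :
    (fun i => (ups τ i).subst (scons a σ)) = scons a (fun i => (τ i).subst σ) := by
  funext i; cases i with
  | zero => rfl
  | succ n => simp [ups, shift, subst_rename]

theorem scons_subst (a : Term Sym) (σ τ : ℕ → Term Sym) :
    (fun i => (scons a σ i).subst τ) = scons (a.subst τ) (fun i => (σ i).subst τ) := by
  funext i; cases i <;> rfl

/-! ## Unfolding in an environment -/

theorem unf_rename (t : Term Sym) (ρ : ℕ → ℕ) : (t.rename ρ).unf = t.unf.rename ρ := by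
  induction t generalizing ρ with
  | var i => rfl
  | sym a => rfl
  | lam t ih => simp [rename, unf, ih]
  | app t w iht ihw => simp [rename, unf, iht, ihw]
  | es t w iht ihw =>
    simp only [rename, unf, iht, ihw, subst_rename, rename_subst, single_eq_scons, scons_comp_upr]
    congr 1; funext i; cases i <;> rfl

theorem unf_ups (σ : ℕ → Term Sym) : (fun i => (ups σ i).unf) = ups (fun i => (σ i).unf) := by
  funext i; cases i with
  | zero => rfl
  | succ n => simp [ups, shift, unf_rename]

theorem unf_subst (t : Term Sym) (σ : ℕ → Term Sym) :
    (t.subst σ).unf = t.unf.subst (fun i => (σ i).unf) := by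
  induction t generalizing σ with
  | var i => rfl
  | sym a => rfl
  | lam t ih => simp [subst, unf, ih, unf_ups]
  | app t w iht ihw => simp [subst, unf, iht, ihw]
  | es t w iht ihw =>
    simp only [subst, unf, iht, ihw, unf_ups, subst_subst, single_eq_scons, ups_scons, scons_subst]
    congr 2; funext i; simp [subst_var]

theorem ESFree.rename {t : Term Sym} (h : t.ESFree) (ρ : ℕ → ℕ) : (t.rename ρ).ESFree := by
  induction t generalizing ρ with
  | var i => trivial
  | sym a => trivial
  | lam t ih => exact ih h _
  | app t w iht ihw => exact ⟨iht h.1 _, ihw h.2 _⟩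
  | es t w iht ihw => exact h.elim

theorem ESFree.subst {t : Term Sym} (h : t.ESFree) {σ : ℕ → Term Sym} (hσ : ∀ i, (σ i).ESFree) :
    (t.subst σ).ESFree := by
  induction t generalizing σ with
  | var i => exact hσ i
  | sym a => trivial
  | lam t ih =>
    refine ih h fun i => ?_
    cases i with
    | zero => trivial
    | succ n => exact (hσ n).rename _
  | app t w iht ihw => exact ⟨iht h.1 hσ, ihw h.2 hσ⟩
  | es t w iht ihw => exact h.elim

theorem unf_esFree (t : Term Sym) : t.unf.ESFree := by
  induction t with
  | var i => trivial
  | sym a => trivial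
  | lam t ih => exact ih
  | app t w iht ihw => exact ⟨iht, ihw⟩
  | es t w iht ihw =>
    refine iht.subst fun i => ?_
    cases i with
    | zero => exact ihw
    | succ n => trivial

theorem ESFree.unf_eq {t : Term Sym} (h : t.ESFree) : t.unf = t := by
  induction t with
  | var i => rfl
  | sym a => rfl
  | lam t ih => simp [unf, ih h]
  | app t w iht ihw => simp [unf, iht h.1, ihw h.2]
  | es t w iht ihw => exact h.elim

/-- The unfolding of `t` in the environment `σ`. -/
def unfIn (σ : ℕ → Term Sym) (t : Term Sym) : Term Sym := t.unf.subst σ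

theorem unfIn_var_env (t : Term Sym) : unfIn var t = t.unf := subst_var _

@[simp] theorem unfIn_var (σ : ℕ → Term Sym) (i : ℕ) : unfIn σ (var i) = σ i := rfl
@[simp] theorem unfIn_app (σ : ℕ → Term Sym) (t w : Term Sym) :
    unfIn σ (app t w) = app (unfIn σ t) (unfIn σ w) := rfl
-- Executing `[x←w]` and then substituting `σ` is one simultaneous substitution. Environments thus
-- absorb the nested substitutions of the contextual definitions.
@[simp] theorem unfIn_es (σ : ℕ → Term Sym) (t w : Term Sym) :
    unfIn σ (es t w) = unfIn (scons (unfIn σ w) σ) t := by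
  simp only [unfIn, unf, subst_subst, single_eq_scons, scons_subst]; rfl

@[simp] theorem unfIn_rename (σ : ℕ → Term Sym) (ρ : ℕ → ℕ) (t : Term Sym) :
    unfIn σ (t.rename ρ) = unfIn (fun i => σ (ρ i)) t := by
  simp only [unfIn, unf_rename, subst_rename]

@[simp] theorem unfIn_shift_one (a : Term Sym) (σ : ℕ → Term Sym) (t : Term Sym) :
    unfIn (scons a σ) (t.shift 1) = unfIn σ t := by
  simp [shift]

theorem unfIn_subst (σ τ : ℕ → Term Sym) (t : Term Sym) :
    unfIn σ (t.subst τ) = unfIn (fun i => unfIn σ (τ i)) t := by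
  simp only [unfIn, unf_subst, subst_subst]

/-- The term has a β-redex that is not under an abstraction. -/
def HasRedex : Term Sym → Prop
  | app t w => t.IsValue ∨ t.HasRedex ∨ w.HasRedex
  | _ => False

-- The head of an inert is a symbol, so its left parts are never abstractions. This is why fireballs
-- are normal, since `HasRedex` does not look under abstractions.
mutual
theorem IsInert.not_hasRedex : {t : Term Sym} → t.IsInert → ¬ t.HasRedex ∧ ¬ t.IsValue
  | _, .sym a => ⟨fun h => h, by rintro ⟨b, hb⟩; cases hb⟩
  | _, .app hA hf => by
    refine ⟨?_, by rintro ⟨b, hb⟩; cases hb⟩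
    rintro (h | h | h)
    · exact hA.not_hasRedex.2 h
    · exact hA.not_hasRedex.1 h
    · exact hf.not_hasRedex h
theorem IsFireball.not_hasRedex : {t : Term Sym} → t.IsFireball → ¬ t.HasRedex
  | _, .value b => fun h => h
  | _, .inert hA => hA.not_hasRedex.1
end

end Term

/-! ## Contexts -/

namespace Ctx

open Term

variable {Sym : Type u}

@[simp] theorem hole_comp (S : Ctx Sym) : hole.comp S = S := rfl

@[simp] theorem comp_hole (S : Ctx Sym) : S.comp hole = S := by
  induction S <;> simp_all [comp]

theorem comp_assoc (S S' S'' : Ctx Sym) : (S.comp S').comp S'' = S.comp (S'.comp S'') := by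
  induction S <;> simp_all [comp]

theorem plug_comp (S S' : Ctx Sym) (t : Term Sym) : (S.comp S').plug t = S.plug (S'.plug t) := by
  induction S <;> simp_all [comp, plug]

theorem depth_comp (S S' : Ctx Sym) : (S.comp S').depth = S.depth + S'.depth := by
  induction S <;> simp_all [comp, depth]; omega

theorem rename_eq_subst (S : Ctx Sym) (ρ : ℕ → ℕ) :
    S.rename ρ = S.subst (fun i => .var (ρ i)) := by
  induction S generalizing ρ <;> simp_all [rename, subst, Term.rename_eq_subst, ups_var_comp]

theorem rename_id (S : Ctx Sym) : S.rename (fun i => i) = S := by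
  induction S <;> simp_all [rename, Term.rename_id, upr_id]

theorem subst_rename (S : Ctx Sym) (ρ : ℕ → ℕ) (σ : ℕ → Term Sym) :
    (S.rename ρ).subst σ = S.subst (fun i => σ (ρ i)) := by
  induction S generalizing ρ σ <;> simp_all [rename, subst, Term.subst_rename, ups_comp_upr]

theorem rename_rename (S : Ctx Sym) (ρ ρ' : ℕ → ℕ) :
    (S.rename ρ).rename ρ' = S.rename (fun i => ρ' (ρ i)) := by
  induction S generalizing ρ ρ' <;> simp_all [rename, Term.rename_rename, upr_comp]

@[simp] theorem depth_rename (S : Ctx Sym) (ρ : ℕ → ℕ) : (S.rename ρ).depth = S.depth := by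
  induction S generalizing ρ <;> simp_all [rename, depth]

theorem rename_comp (S S' : Ctx Sym) (ρ : ℕ → ℕ) :
    (S.comp S').rename ρ = (S.rename ρ).comp (S'.rename (upr^[S.depth] ρ)) := by
  induction S generalizing ρ <;> simp_all [comp, rename, depth]

theorem plug_rename (S : Ctx Sym) (t : Term Sym) (ρ : ℕ → ℕ) :
    (S.plug t).rename ρ = (S.rename ρ).plug (t.rename (upr^[S.depth] ρ)) := by
  induction S generalizing ρ <;> simp_all [plug, rename, depth, Term.rename]

theorem plug_subst (S : Ctx Sym) (t : Term Sym) (σ : ℕ → Term Sym) :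
    (S.plug t).subst σ = (S.subst σ).plug (t.subst (ups^[S.depth] σ)) := by
  induction S generalizing σ <;> simp_all [plug, subst, depth, Term.subst]

/-- The environment at the hole of a context that is itself read in the environment `σ`. -/
def env (σ : ℕ → Term Sym) : Ctx Sym → ℕ → Term Sym
  | hole => σ
  | appR _ S => S.env σ
  | appL S _ => S.env σ
  | es S t => S.env (scons (unfIn σ t) σ)

/-- Evaluability of a context in the environment `σ`. -/
def EvalIn (σ : ℕ → Term Sym) : Ctx Sym → Prop
  | hole => True
  | appR _ S => S.EvalIn σ
  | appL S t => S.EvalIn σ ∧ (unfIn σ t).IsFireball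
  | es S t => S.EvalIn (scons (unfIn σ t) σ) ∧ (unfIn σ t).IsFireball

/-- Whether the hole is applied, when `b` tells whether the whole context is. -/
def applied (b : Bool) : Ctx Sym → Bool
  | hole => b
  | appR _ S => S.applied false
  | appL S _ => S.applied true
  | es S _ => S.applied b

theorem env_comp (σ : ℕ → Term Sym) (S S' : Ctx Sym) : (S.comp S').env σ = S'.env (S.env σ) := by
  induction S generalizing σ <;> simp_all [comp, env]

theorem evalIn_comp (σ : ℕ → Term Sym) (S S' : Ctx Sym) :
    (S.comp S').EvalIn σ ↔ S.EvalIn σ ∧ S'.EvalIn (S.env σ) := by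
  induction S generalizing σ <;> simp_all [comp, env, EvalIn] <;> tauto

theorem applied_comp (b : Bool) (S S' : Ctx Sym) :
    (S.comp S').applied b = S'.applied (S.applied b) := by
  induction S generalizing b <;> simp only [comp, applied, *]

theorem IsSubst.applied {L : Ctx Sym} (h : L.IsSubst) (b : Bool) : L.applied b = b := by
  induction L <;> simp_all [IsSubst, Ctx.applied]

theorem IsSubst.comp {L L' : Ctx Sym} (h : L.IsSubst) (h' : L'.IsSubst) :
    (L.comp L').IsSubst := by
  induction L <;> simp_all [IsSubst, Ctx.comp]

theorem unfIn_plug_of_isSubst {L : Ctx Sym} (h : L.IsSubst) (σ : ℕ → Term Sym) (t : Term Sym) :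
    unfIn σ (L.plug t) = unfIn (L.env σ) t := by
  induction L generalizing σ <;> simp_all [IsSubst, plug, env]

/-- The final substitution by `σ` is the generalization needed for the induction: crossing an
explicit substitution extends `σ`. -/
theorem relUnf_subst (r : Term Sym) (S : Ctx Sym) (σ : ℕ → Term Sym) :
    (relUnf r S).subst σ = unfIn (S.env σ) r := by
  induction S generalizing σ with
  | hole => rfl
  | appR t S ih => exact ih σ
  | appL S t ih => exact ih σ
  | es S t ih =>
    simp only [relUnf, subst_subst, single_eq_scons, scons_subst, env, ← ih]; rfl

theorem relUnf_eq (r : Term Sym) (S : Ctx Sym) : relUnf r S = unfIn (S.env .var) r := by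
  rw [← relUnf_subst, subst_var]

theorem unfIn_ups (σ τ : ℕ → Term Sym) (a : Term Sym) :
    (fun i => unfIn (scons a σ) (ups τ i)) = scons a (fun i => unfIn σ (τ i)) := by
  funext i; cases i with
  | zero => rfl
  | succ n => simp [ups]

/-- A substitution performed in a context can be moved to its environment. This reconciles `EvalIn`
with `Evaluable`, which substitutes in the context itself. -/
theorem evalIn_subst (S : Ctx Sym) (σ τ : ℕ → Term Sym) :
    (S.subst τ).EvalIn σ ↔ S.EvalIn (fun i => unfIn σ (τ i)) := by
  induction S generalizing σ τ <;> simp_all [subst, EvalIn, unfIn_subst, unfIn_ups]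

theorem evalIn_subst_single (S : Ctx Sym) (t : Term Sym) :
    (S.subst (single t.unf)).EvalIn .var ↔ S.EvalIn (scons t.unf .var) := by
  rw [evalIn_subst]
  have : (fun i => unfIn .var (single t.unf i)) = scons t.unf .var := by
    funext i; cases i with
    | zero => simp [unfIn_var_env, single, (unf_esFree t).unf_eq]
    | succ n => rfl
  rw [this]

/-- The number of constructors on the spine of a context. -/
def length : Ctx Sym → ℕ
  | hole => 0
  | appR _ S => S.length + 1
  | appL S _ => S.length + 1
  | es S _ => S.length + 1

theorem length_subst (S : Ctx Sym) (σ : ℕ → Term Sym) : (S.subst σ).length = S.length := by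
  induction S generalizing σ <;> simp_all [subst, length]

/-- The rule of `Evaluable` for explicit substitutions has a substituted context as premise, which
is not a subcontext. The induction is therefore on the length of the spine, which substitution
preserves. -/
theorem evaluable_of_evalIn (n : ℕ) (S : Ctx Sym) (hn : S.length = n) (h : S.EvalIn .var) :
    S.Evaluable := by
  induction n generalizing S with
  | zero => cases S <;> first | exact .hole | simp [length] at hn
  | succ n ih =>
    cases S with
    | hole => exact .hole
    | appR t S => exact .appR (ih S (by simpa [length] using hn) h)
    | appL S t =>
      exact .appL (ih S (by simpa [length] using hn) h.1) (by simpa [unfIn_var_env] using h.2)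
    | es S t =>
      have h' := h
      simp only [EvalIn, unfIn_var_env] at h'
      exact .es (ih _ (by simpa [length, length_subst] using hn)
        ((evalIn_subst_single S t).2 h'.1)) h'.2

theorem evaluable_iff (S : Ctx Sym) : S.Evaluable ↔ S.EvalIn .var := by
  refine ⟨fun h => ?_, evaluable_of_evalIn _ S rfl⟩
  induction h with
  | hole => trivial
  | appL _ ht ih => exact ⟨ih, by rwa [unfIn_var_env]⟩
  | appR _ ih => exact ih
  | es _ ht ih =>
    rw [evalIn_subst_single] at ih
    simp only [EvalIn, unfIn_var_env]
    exact ⟨ih, ht⟩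

/-- The first alternative covers an application lying outside `S`, which still applies the hole only
if `S` is a substitution context; it becomes an applicative context at the next `appL`. -/
theorem applied_true {S : Ctx Sym} {b : Bool} (h : S.applied b = true) :
    (b = true ∧ S.IsSubst) ∨ S.Applicative := by
  induction S generalizing b with
  | hole => exact .inl ⟨h, trivial⟩
  | appR t S ih =>
    rcases ih h with ⟨h', _⟩ | ⟨S', L, w, hL, rfl⟩
    · cases h'
    · exact .inr ⟨appR t S', L, w, hL, rfl⟩
  | appL S t ih =>
    rcases ih h with ⟨_, h'⟩ | ⟨S', L, w, hL, rfl⟩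
    · exact .inr ⟨hole, S, t, h', rfl⟩
    · exact .inr ⟨appL S' t, L, w, hL, rfl⟩
  | es S t ih =>
    rcases ih h with ⟨h', h''⟩ | ⟨S', L, w, hL, rfl⟩
    · exact .inl ⟨h', h''⟩
    · exact .inr ⟨es S' t, L, w, hL, rfl⟩

theorem applicative_iff (S : Ctx Sym) : S.Applicative ↔ S.applied false = true := by
  constructor
  · rintro ⟨S', L, t, hL, rfl⟩
    simp [applied_comp, applied, hL.applied]
  · intro h
    rcases applied_true h with ⟨h', _⟩ | h'
    · cases h'
    · exact h'

theorem useful_iff (S : Ctx Sym) : S.Useful ↔ S.EvalIn .var ∧ S.applied false = true := by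
  rw [Useful, evaluable_iff, applicative_iff]

end Ctx

/-! ## The redex of a term, as a function -/

namespace Term

variable {Sym : Type u}

/-- `push F ρ L⟨v⟩ = L⟨F ρ' v⟩`, where `L` is the maximal substitution context around `v` and `ρ'`
weakens the target of `ρ` by the binders of `L`. -/
def push (F : (ℕ → ℕ) → Term Sym → Term Sym) : (ℕ → ℕ) → Term Sym → Term Sym
  | ρ, es t w => es (push F (fun i => ρ i + 1) t) w
  | ρ, var i => F ρ (var i)
  | ρ, sym a => F ρ (sym a)
  | ρ, lam t => F ρ (lam t)
  | ρ, app t w => F ρ (app t w)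

theorem push_of_not_es (F : (ℕ → ℕ) → Term Sym → Term Sym) (ρ : ℕ → ℕ) {v : Term Sym}
    (hv : ∀ p q, v ≠ es p q) : push F ρ v = F ρ v := by
  cases v with
  | es p q => exact absurd rfl (hv p q)
  | _ => rfl

theorem push_plug (F : (ℕ → ℕ) → Term Sym → Term Sym) (ρ : ℕ → ℕ) {L : Ctx Sym} (hL : L.IsSubst)
    {v : Term Sym} (hv : ∀ p q, v ≠ es p q) :
    push F ρ (L.plug v) = L.plug (F (fun i => ρ i + L.depth) v) := by
  induction L generalizing ρ with
  | hole => exact push_of_not_es F ρ hv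
  | es L t ih =>
    simp only [Ctx.plug, push, ih _ hL, Ctx.depth]
    congr 4; funext i; omega
  | _ => exact hL.elim

/-- Compatibility with renamings of a function in the sense of `push`. -/
def Natural (F : (ℕ → ℕ) → Term Sym → Term Sym) : Prop :=
  ∀ ρ ρ' v, (F ρ v).rename ρ' = F (fun i => ρ' (ρ i)) (v.rename ρ')

theorem push_rename {F : (ℕ → ℕ) → Term Sym → Term Sym} (hF : Natural F) (ρ ρ' : ℕ → ℕ)
    (t : Term Sym) : (push F ρ t).rename ρ' = push F (fun i => ρ' (ρ i)) (t.rename ρ') := by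
  induction t generalizing ρ ρ' with
  | es t w iht ihw => simp only [push, rename, iht]; rfl
  | _ => exact hF _ _ _

/-- `push` calls its function only at renamings weakened by the number of substitutions crossed, so
agreement at those suffices. -/
theorem push_congr_fun {F G : (ℕ → ℕ) → Term Sym → Term Sym} (ρ ρ' : ℕ → ℕ) (t : Term Sym)
    (h : ∀ (k : ℕ) v, F (fun i => ρ i + k) v = G (fun i => ρ' i + k) v) :
    push F ρ t = push G ρ' t := by
  induction t generalizing ρ ρ' with
  | es t w iht ihw =>
    simp only [push]
    rw [iht]
    intro k v
    have := h (1 + k) v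
    simpa only [Nat.add_assoc] using this
  | _ => exact h 0 _

/-- Firing of the β-redex formed by an abstraction and the argument `w`; the value elsewhere is
chosen so that the operation commutes with structural equivalence. -/
def fireMul (w : Term Sym) (ρ : ℕ → ℕ) : Term Sym → Term Sym
  | lam b => es b (w.rename ρ)
  | v => es (v.shift 1) (w.rename ρ)

/-- The substitution replacing variable `0` with `v` and leaving variable `1` bound. -/
def expEnv (ρ : ℕ → ℕ) (v : Term Sym) : ℕ → Term Sym :=
  scons (v.shift 1) (scons (var 0) fun i => var (ρ i + 1))

/-- Replacement, in the scope of a substitution for variable `1`, of the marked occurrence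
(variable `0`). -/
def fireExp (P : Term Sym) (ρ : ℕ → ℕ) (v : Term Sym) : Term Sym := es (P.subst (expEnv ρ v)) v

theorem expEnv_rename (ρ ρ' : ℕ → ℕ) (v : Term Sym) :
    (fun i => (expEnv ρ v i).rename (upr ρ')) = expEnv (fun i => ρ' (ρ i)) (v.rename ρ') := by
  funext i
  match i with
  | 0 => simp [expEnv, shift, rename_rename, upr]
  | 1 => rfl
  | i + 2 => rfl

theorem natural_fireMul (w : Term Sym) : Natural (fireMul w) := by
  intro ρ ρ' v
  have h := rename_shift_one v ρ'
  cases v <;> simp only [fireMul, rename, rename_rename]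
  all_goals exact congrArg₂ es h rfl

theorem natural_fireExp (P : Term Sym) : Natural (fireExp P) := by
  intro ρ ρ' v
  simp [fireExp, rename, rename_subst, expEnv_rename]

theorem push_fireMul_rename (t w : Term Sym) (ρ : ℕ → ℕ) :
    (push (fireMul w) (fun i => i) t).rename ρ
      = push (fireMul (w.rename ρ)) (fun i => i) (t.rename ρ) := by
  rw [push_rename (natural_fireMul w)]
  refine push_congr_fun _ _ _ fun k v => ?_
  cases v <;> simp [fireMul, rename_rename]

theorem push_fireExp_rename (P w : Term Sym) (ρ : ℕ → ℕ) :
    (push (fireExp P) (fun i => i) w).rename ρ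
      = push (fireExp (P.rename (upr (upr ρ)))) (fun i => i) (w.rename ρ) := by
  rw [push_rename (natural_fireExp P)]
  refine push_congr_fun _ _ _ fun k v => ?_
  simp only [fireExp, subst_rename]
  congr 2; funext i
  match i with
  | 0 => rfl
  | 1 => rfl
  | i + 2 => rfl

end Term

open Term

/-- What the search for a redex in a term returns: nothing; an abstraction in applied position;
a redex, with its kind and the reduct; or a variable in applied position, free in the term, and the
term where that occurrence is marked, i.e. replaced with a new variable of index `0`. -/
inductive Outcome (Sym : Type u) : Type u
  | none
  | abs
  | step (k : RuleKind) (t : Term Sym)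
  | head (i : ℕ) (P : Term Sym)

namespace Outcome

variable {Sym : Type u}

def rename (ρ : ℕ → ℕ) : Outcome Sym → Outcome Sym
  | none => none
  | abs => abs
  | step k t => step k (t.rename ρ)
  | head i P => head (ρ i) (P.rename (upr ρ))

def appR (t : Term Sym) : Outcome Sym → Outcome Sym
  | step k w => step k (app t w)
  | head i P => head i (app (t.shift 1) P)
  | _ => none

def appL (t w : Term Sym) : Outcome Sym → Outcome Sym
  | none => none
  | abs => step .mul (push (fireMul w) (fun i => i) t)
  | step k t' => step k (app t' w)
  | head i P => head i (app P (w.shift 1))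

/-- Index `0` is the variable bound here, so its occurrence is replaced. For any other variable the
marker must stay innermost in the scope, whence the exchange with the new binder. -/
def es (w : Term Sym) : Outcome Sym → Outcome Sym
  | none => none
  | abs => abs
  | step k t => step k (.es t w)
  | head 0 P => step .exp (push (fireExp P) (fun i => i) w)
  | head (i + 1) P => head i (.es (P.rename swap01) (w.shift 1))

end Outcome

open Classical in
/-- The search for a redex in a term in the environment `σ`, where `b` tells whether the term is
applied. -/
noncomputable def redex {Sym : Type u} : (ℕ → Term Sym) → Bool → Term Sym → Outcome Sym
  | σ, b, var i => if b = true ∧ (σ i).IsValue then .head i (var 0) else .none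
  | _, _, sym _ => .none
  | _, b, lam _ => if b = true then .abs else .none
  | σ, _, app t w =>
    if (unfIn σ w).IsFireball then (redex σ true t).appL t w else (redex σ false w).appR t
  | σ, b, es t w =>
    if (unfIn σ w).IsFireball then (redex (scons (unfIn σ w) σ) b t).es w else .none

variable {Sym : Type u}

theorem redex_app_pos {σ : ℕ → Term Sym} {w : Term Sym} (h : (unfIn σ w).IsFireball) (b : Bool)
    (t : Term Sym) : redex σ b (app t w) = (redex σ true t).appL t w := by
  simp only [redex, if_pos h]

theorem redex_app_neg {σ : ℕ → Term Sym} {w : Term Sym} (h : ¬ (unfIn σ w).IsFireball) (b : Bool)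
    (t : Term Sym) : redex σ b (app t w) = (redex σ false w).appR t := by
  simp only [redex, if_neg h]

theorem redex_es_pos {σ : ℕ → Term Sym} {w : Term Sym} (h : (unfIn σ w).IsFireball) (b : Bool)
    (t : Term Sym) : redex σ b (es t w) = (redex (scons (unfIn σ w) σ) b t).es w := by
  simp only [redex, if_pos h]

/-- Whatever the search finds survives unfolding, either as a redex outside abstractions or as the
whole term becoming an applied value. So a subterm where something is found in unapplied position
does not unfold to a fireball, and the search cannot skip it. -/
theorem redex_ne_none {σ : ℕ → Term Sym} {b : Bool} {t : Term Sym} (h : redex σ b t ≠ .none) :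
    (unfIn σ t).HasRedex ∨ (b = true ∧ (unfIn σ t).IsValue) := by
  induction t generalizing σ b with
  | var i =>
    by_cases hb : b = true ∧ (σ i).IsValue
    · exact .inr hb
    · simp [redex, hb] at h
  | sym a => simp [redex] at h
  | lam t =>
    by_cases hb : b = true
    · exact .inr ⟨hb, _, rfl⟩
    · simp [redex, hb] at h
  | app t w iht ihw =>
    left
    by_cases hw : (unfIn σ w).IsFireball
    · simp only [redex, if_pos hw] at h
      have h' : redex σ true t ≠ .none := by rintro e; rw [e] at h; exact h rfl
      rcases iht h' with h | h
      · exact .inr (.inl h)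
      · exact .inl h.2
    · simp only [redex, if_neg hw] at h
      have h' : redex σ false w ≠ .none := by rintro e; rw [e] at h; exact h rfl
      rcases ihw h' with h | h
      · exact .inr (.inr h)
      · exact absurd h.1 (by simp)
  | es t w iht ihw =>
    by_cases hw : (unfIn σ w).IsFireball
    · simp only [redex, if_pos hw] at h
      have h' : redex (scons (unfIn σ w) σ) b t ≠ .none := by
        rintro e; rw [e] at h; exact h rfl
      simpa using iht h'
    · simp [redex, if_neg hw] at h

theorem not_isFireball_of_redex {σ : ℕ → Term Sym} {t : Term Sym}
    (h : redex σ false t ≠ .none) : ¬ (unfIn σ t).IsFireball := by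
  rcases redex_ne_none h with h | h
  · exact fun hf => hf.not_hasRedex h
  · exact absurd h.1 (by simp)

/-- Renaming amounts to reindexing the environment. The rules of structural equivalence weaken or
permute variables, and this lemma makes the search ignore that. -/
theorem redex_rename (σ : ℕ → Term Sym) (b : Bool) (ρ : ℕ → ℕ) (t : Term Sym) :
    redex σ b (t.rename ρ) = (redex (fun i => σ (ρ i)) b t).rename ρ := by
  induction t generalizing σ b ρ with
  | var i => simp only [rename, redex]; split_ifs <;> rfl
  | sym a => rfl
  | lam t => simp only [rename, redex]; split_ifs <;> rfl
  | app t w iht ihw =>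
    by_cases hw : (unfIn (fun i => σ (ρ i)) w).IsFireball
    · have hw' : (unfIn σ (w.rename ρ)).IsFireball := by rwa [unfIn_rename]
      simp only [rename, redex, if_pos hw, if_pos hw', iht]
      cases redex (fun i => σ (ρ i)) true t <;>
        simp [Outcome.appL, Outcome.rename, push_fireMul_rename, rename, shift, rename_rename, upr]
    · have hw' : ¬ (unfIn σ (w.rename ρ)).IsFireball := by rwa [unfIn_rename]
      simp only [rename, redex, if_neg hw, if_neg hw', ihw]
      cases redex (fun i => σ (ρ i)) false w <;>
        simp [Outcome.appR, Outcome.rename, rename, shift, rename_rename, upr]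
  | es t w iht ihw =>
    by_cases hw : (unfIn (fun i => σ (ρ i)) w).IsFireball
    · have hw' : (unfIn σ (w.rename ρ)).IsFireball := by rwa [unfIn_rename]
      simp only [rename, redex, if_pos hw, if_pos hw', iht, scons_comp_upr, unfIn_rename]
      rcases redex (scons (unfIn (fun i => σ (ρ i)) w) fun i => σ (ρ i)) b t with
        _ | _ | ⟨k, t'⟩ | ⟨_ | i, P⟩
      · rfl
      · rfl
      · rfl
      · simp [Outcome.es, Outcome.rename, push_fireExp_rename, upr]
      · simp only [Outcome.es, Outcome.rename, upr, rename, shift, rename_rename]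
        congr 3; funext j
        match j with
        | 0 => rfl
        | 1 => rfl
        | j + 2 => rfl
    · have hw' : ¬ (unfIn σ (w.rename ρ)).IsFireball := by rwa [unfIn_rename]
      simp only [rename, redex, if_neg hw, if_neg hw']
      rfl

/-! ### Comparison with the contextual rules -/

section ContextualRules

open Ctx

theorem redex_plug_step {σ : ℕ → Term Sym} {b : Bool} {S : Ctx Sym} (hS : S.EvalIn σ)
    {r r' : Term Sym} {k : RuleKind} (h : redex (S.env σ) (S.applied b) r = .step k r') :
    redex σ b (S.plug r) = .step k (S.plug r') := by
  induction S generalizing σ b with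
  | hole => exact h
  | appR t S ih =>
    have := ih hS h
    -- The argument contains a redex, so its fireball test fails and the search enters it rather
    -- than `t`.
    have hf : ¬ (unfIn σ (S.plug r)).IsFireball := not_isFireball_of_redex (by rw [this]; simp)
    simp [plug, redex, hf, this, Outcome.appR]
  | appL S t ih => simp [plug, redex, hS.2, ih hS.1 h, Outcome.appL]
  | es S t ih => simp [plug, redex, hS.2, ih hS.1 h, Outcome.es]

theorem redex_plug_abs {σ : ℕ → Term Sym} {L : Ctx Sym} (hS : L.EvalIn σ) (hL : L.IsSubst)
    (t : Term Sym) : redex σ true (L.plug (lam t)) = .abs := by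
  induction L generalizing σ with
  | hole => simp [plug, redex]
  | es L w ih => simp [plug, redex, hS.2, ih hS.1 hL, Outcome.es]
  | _ => exact hL.elim

/-- The term `S⟨x⟩` where the displayed occurrence of `x` is marked. -/
def Ctx.mark (S : Ctx Sym) : Term Sym := (S.rename (· + 1)).plug (var S.depth)

theorem Ctx.mark_es (S : Ctx Sym) (t : Term Sym) :
    (Ctx.es S t).mark = .es (S.mark.rename swap01) (t.shift 1) := by
  -- Beyond the `n` variables bound above the hole, the lifted renaming is `ρ` up to a shift; it is
  -- used at the marker, which has index `S.depth` at the hole.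
  have h : ∀ (n : ℕ) (ρ : ℕ → ℕ) (m : ℕ), upr^[n] ρ (m + n) = ρ m + n := by
    intro n
    induction n with
    | zero => intros; rfl
    | succ n ih =>
      intro ρ m
      rw [Function.iterate_succ_apply, ← Nat.add_assoc, Nat.add_right_comm, ih]
      simp only [upr]; omega
  have h0 : upr^[S.depth] swap01 S.depth = 1 + S.depth := by
    simpa [swap01] using h S.depth swap01 0
  simp only [Ctx.mark, Ctx.rename, plug, depth, plug_rename, depth_rename, Term.rename, h0,
    shift, Ctx.rename_rename, Nat.add_comm 1]
  congr 3; funext i; cases i <;> rfl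

/-- Filling the marker with `v` gives the body of the contextual reduct: only the displayed
occurrence is replaced, and the substituted variable stays bound. -/
theorem Ctx.mark_subst_expEnv (S : Ctx Sym) (ρ : ℕ → ℕ) (v : Term Sym) :
    S.mark.subst (expEnv ρ v) = (S.rename (upr ρ)).plug (v.shift (S.depth + 1)) := by
  have h : ∀ (n : ℕ) (σ : ℕ → Term Sym) (m : ℕ), ups^[n] σ (m + n) = (σ m).shift n := by
    intro n
    induction n with
    | zero => intro σ m; exact (shift_zero _).symm
    | succ n ih =>
      intro σ m
      rw [Function.iterate_succ_apply, ← Nat.add_assoc, Nat.add_right_comm, ih]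
      simp only [ups, shift, Term.rename_rename]
      congr 1; funext i; omega
  have h0 : ups^[S.depth] (expEnv ρ v) S.depth = (v.shift 1).shift S.depth := by
    simpa [expEnv] using h S.depth (expEnv ρ v) 0
  simp only [Ctx.mark, plug_subst, depth_rename, Term.subst, h0, Ctx.subst_rename,
    Ctx.rename_eq_subst S (upr ρ), shift, Term.rename_rename]
  congr 2
  · funext i; cases i <;> rfl
  · funext i; omega

theorem redex_plug_head {σ : ℕ → Term Sym} {b : Bool} {S : Ctx Sym} (hS : S.EvalIn σ)
    (hb : S.applied b = true) {i : ℕ} (hi : (σ i).IsValue) :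
    redex σ b (S.plug (var (i + S.depth))) = .head i S.mark := by
  induction S generalizing σ b i with
  | hole => simp_all [plug, redex, Ctx.mark, Ctx.rename, depth, applied]
  | appR t S ih =>
    have := ih hS hb hi
    have hf : ¬ (unfIn σ (S.plug (var (i + S.depth)))).IsFireball :=
      not_isFireball_of_redex (by rw [this]; simp)
    simp [plug, redex, hf, this, Outcome.appR, Ctx.mark, Ctx.rename, depth, shift]
  | appL S t ih =>
    have := ih hS.1 hb hi
    simp [plug, redex, hS.2, this, Outcome.appL, Ctx.mark, Ctx.rename, depth, shift]
  | es S t ih =>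
    have := ih (i := i + 1) hS.1 hb hi
    rw [show i + 1 + S.depth = i + (Ctx.es S t).depth by simp only [depth]; omega] at this
    simp only [plug, redex, if_pos hS.2, this, Outcome.es, Ctx.mark_es]

/-- Evaluability makes every fireball test on the path to the redex succeed, so the search follows
exactly the contexts of the rule. -/
theorem UStep.redex_eq {k : RuleKind} {t t' : Term Sym} (h : UStep k t t') :
    redex var false t = .step k t' := by
  cases h with
  | um S L t w hL hu =>
    rw [useful_iff, evalIn_comp, applied_comp] at hu
    obtain ⟨⟨hS, hL', hw⟩, -⟩ := hu
    refine redex_plug_step hS ?_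
    simp only [redex, if_pos hw, redex_plug_abs hL' hL, Outcome.appL]
    rw [push_plug _ _ hL (by simp)]
    rfl
  | ue S S' L w hL hu hw hv =>
    rw [useful_iff, evalIn_comp, applied_comp] at hu
    obtain ⟨⟨hS, hS', hLw⟩, ha⟩ := hu
    refine redex_plug_step hS ?_
    rw [relUnf_eq, env_comp, ← unfIn_plug_of_isSubst hL] at hv
    have := redex_plug_head (i := 0) hS' ha hv
    rw [Nat.zero_add] at this
    simp only [redex, if_pos hLw, this, Outcome.es]
    rw [push_plug _ _ hL hw]
    simp only [fireExp, Ctx.mark_subst_expEnv]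

theorem redex_eq_abs {σ : ℕ → Term Sym} {b : Bool} {t : Term Sym} (h : redex σ b t = .abs) :
    ∃ L : Ctx Sym, ∃ p, L.IsSubst ∧ L.EvalIn σ ∧ t = L.plug (lam p) := by
  induction t generalizing σ b with
  | var i => simp only [redex] at h; split_ifs at h
  | sym a => simp [redex] at h
  | lam t => exact ⟨.hole, t, trivial, trivial, rfl⟩
  | app t w iht ihw =>
    simp only [redex] at h
    split_ifs at h
    · cases e : redex σ true t <;> simp [e, Outcome.appL] at h
    · cases e : redex σ false w <;> simp [e, Outcome.appR] at h
  | es t w iht ihw =>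
    simp only [redex] at h
    split_ifs at h with hw
    rcases e : redex (scons (unfIn σ w) σ) b t with _ | _ | ⟨k, t'⟩ | ⟨_ | i, P⟩ <;>
      simp [e, Outcome.es] at h
    obtain ⟨L, p, hL, hL', rfl⟩ := iht e
    exact ⟨.es L w, p, hL, ⟨hL', hw⟩, rfl⟩

theorem redex_eq_head {σ : ℕ → Term Sym} {b : Bool} {t : Term Sym} {i : ℕ} {P : Term Sym}
    (h : redex σ b t = .head i P) :
    (σ i).IsValue ∧ ∃ S : Ctx Sym, S.EvalIn σ ∧ S.applied b = true ∧
      t = S.plug (var (i + S.depth)) ∧ P = S.mark := by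
  induction t generalizing σ b i P with
  | var j =>
    simp only [redex] at h
    split_ifs at h with hj
    cases h
    exact ⟨hj.2, .hole, trivial, hj.1, rfl, rfl⟩
  | sym a => simp [redex] at h
  | lam t => simp only [redex] at h; split_ifs at h
  | app t w iht ihw =>
    simp only [redex] at h
    split_ifs at h with hw
    · cases e : redex σ true t <;> simp [e, Outcome.appL] at h
      obtain ⟨rfl, rfl⟩ := h
      obtain ⟨hi, S, hS, ha, rfl, rfl⟩ := iht e
      exact ⟨hi, .appL S w, ⟨hS, hw⟩, ha, rfl, rfl⟩
    · cases e : redex σ false w <;> simp [e, Outcome.appR] at h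
      obtain ⟨rfl, rfl⟩ := h
      obtain ⟨hi, S, hS, ha, rfl, rfl⟩ := ihw e
      exact ⟨hi, .appR t S, hS, ha, rfl, rfl⟩
  | es t w iht ihw =>
    simp only [redex] at h
    split_ifs at h with hw
    rcases e : redex (scons (unfIn σ w) σ) b t with _ | _ | ⟨k, t'⟩ | ⟨_ | j, P⟩ <;>
      simp [e, Outcome.es] at h
    obtain ⟨rfl, rfl⟩ := h
    obtain ⟨hi, S, hS, ha, rfl, rfl⟩ := iht e
    refine ⟨hi, .es S w, ⟨hS, hw⟩, ha, ?_, (Ctx.mark_es S w).symm⟩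
    simp only [plug, depth]
    congr 3; omega

theorem exists_isSubst_plug (t : Term Sym) :
    ∃ L : Ctx Sym, ∃ v, L.IsSubst ∧ (∀ p q, v ≠ .es p q) ∧ t = L.plug v := by
  induction t with
  | es t w iht ihw =>
    obtain ⟨L, v, hL, hv, rfl⟩ := iht
    exact ⟨.es L w, v, hL, hv, rfl⟩
  | _ => exact ⟨.hole, _, trivial, by simp, rfl⟩

/-- The strategy, for a term in the environment `σ`, applied or not according to `b`. -/
inductive UStepIn (σ : ℕ → Term Sym) (b : Bool) : RuleKind → Term Sym → Term Sym → Prop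
  | um (S L : Ctx Sym) (t w : Term Sym) :
      L.IsSubst → (S.comp (.appL L w)).EvalIn σ →
      UStepIn σ b .mul (S.plug (.app (L.plug (.lam t)) w))
        (S.plug (L.plug (.es t (w.shift L.depth))))
  | ue (S S' L : Ctx Sym) (w : Term Sym) :
      L.IsSubst → (S.comp (.es S' (L.plug w))).EvalIn σ →
      (S.comp (.es S' (L.plug w))).applied b = true →
      (∀ p q, w ≠ .es p q) → (unfIn ((S.comp L).env σ) w).IsValue →
      UStepIn σ b .exp (S.plug (.es (S'.plug (.var S'.depth)) (L.plug w)))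
        (S.plug (L.plug
          (.es ((S'.rename (upr (fun i => i + L.depth))).plug (w.shift (S'.depth + 1))) w)))

theorem UStepIn.plug {σ : ℕ → Term Sym} {b : Bool} {k : RuleKind} {r r' : Term Sym} {S : Ctx Sym}
    (hS : S.EvalIn σ) (h : UStepIn (S.env σ) (S.applied b) k r r') :
    UStepIn σ b k (S.plug r) (S.plug r') := by
  cases h with
  | um S' L t w hL hu =>
    rw [← plug_comp, ← plug_comp]
    refine .um _ L t w hL ?_
    rw [comp_assoc, evalIn_comp]
    exact ⟨hS, hu⟩
  | ue S' S'' L w hL hu ha hw hv =>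
    rw [← plug_comp, ← plug_comp]
    refine .ue _ S'' L w hL ?_ ?_ hw ?_
    · rw [comp_assoc, evalIn_comp]
      exact ⟨hS, hu⟩
    · rwa [comp_assoc, applied_comp]
    · rwa [comp_assoc, env_comp]

/-- The path followed by the search is itself the evaluable context of the rule. The induction goes
under substitutions and applications, whence arbitrary `σ` and `b`. -/
theorem redex_eq_step {σ : ℕ → Term Sym} {b : Bool} {t t' : Term Sym} {k : RuleKind}
    (h : redex σ b t = .step k t') : UStepIn σ b k t t' := by
  induction t generalizing σ b t' with
  | var j => simp only [redex] at h; split_ifs at h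
  | sym a => simp [redex] at h
  | lam t => simp only [redex] at h; split_ifs at h
  | app t w iht ihw =>
    simp only [redex] at h
    split_ifs at h with hw
    · cases e : redex σ true t <;> simp [e, Outcome.appL] at h
      · obtain ⟨rfl, rfl⟩ := h
        obtain ⟨L, p, hL, hL', rfl⟩ := redex_eq_abs e
        rw [push_plug _ _ hL (by simp)]
        exact .um .hole L p w hL ⟨hL', hw⟩
      · obtain ⟨rfl, rfl⟩ := h
        exact UStepIn.plug (S := .appL .hole w) ⟨trivial, hw⟩ (iht e)
    · cases e : redex σ false w <;> simp [e, Outcome.appR] at h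
      obtain ⟨rfl, rfl⟩ := h
      exact UStepIn.plug (S := .appR t .hole) trivial (ihw e)
  | es t w iht ihw =>
    simp only [redex] at h
    split_ifs at h with hw
    rcases e : redex (scons (unfIn σ w) σ) b t with _ | _ | ⟨k, t'⟩ | ⟨_ | j, P⟩ <;>
      simp [e, Outcome.es] at h
    · obtain ⟨rfl, rfl⟩ := h
      exact UStepIn.plug (S := .es .hole w) ⟨trivial, hw⟩ (iht e)
    · obtain ⟨rfl, rfl⟩ := h
      obtain ⟨hi, S, hS, ha, rfl, rfl⟩ := redex_eq_head e
      obtain ⟨L, v, hL, hv, rfl⟩ := exists_isSubst_plug w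
      rw [push_plug _ _ hL hv, fireExp, Ctx.mark_subst_expEnv, Nat.zero_add]
      refine .ue .hole S L v hL ⟨hS, hw⟩ ha hv ?_
      rw [hole_comp, ← unfIn_plug_of_isSubst hL]
      exact hi

theorem uStep_iff_redex (k : RuleKind) (t t' : Term Sym) :
    UStep k t t' ↔ redex var false t = .step k t' := by
  refine ⟨UStep.redex_eq, fun h => ?_⟩
  cases redex_eq_step h with
  | um S L t w hL hu =>
    refine .um S L t w hL ((useful_iff _).2 ⟨hu, ?_⟩)
    -- In the multiplicative rule the context is applicative by its very shape, so `UStepIn.um` does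
    -- not ask for it.
    simp [applied_comp, applied, hL.applied]
  | ue S S' L w hL hu ha hw hv =>
    exact .ue S S' L w hL ((useful_iff _).2 ⟨hu, ha⟩) hw (by rwa [relUnf_eq])

theorem UStep.deterministic {k₁ k₂ : RuleKind} {t t₁ t₂ : Term Sym} (h₁ : UStep k₁ t t₁)
    (h₂ : UStep k₂ t t₂) : k₁ = k₂ ∧ t₁ = t₂ := by
  have := h₁.redex_eq.symm.trans h₂.redex_eq
  simpa using this

theorem UStep.not_isFireball {k : RuleKind} {t t' : Term Sym} (h : UStep k t t') :
    ¬ t.unf.IsFireball := by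
  rw [← unfIn_var_env]
  exact not_isFireball_of_redex (by rw [h.redex_eq]; simp)

end ContextualRules

/-! ## Structural equivalence -/

theorem swap01_swap01 (i : ℕ) : swap01 (swap01 i) = i := by
  match i with
  | 0 => rfl
  | 1 => rfl
  | i + 2 => rfl

theorem StructEq.of_eq {t w : Term Sym} (h : t = w) : StructEq t w := h ▸ .refl t

theorem StructEq.subst {t w : Term Sym} (h : StructEq t w) (σ : ℕ → Term Sym) :
    StructEq (t.subst σ) (w.subst σ) := by
  have hs : ∀ (σ : ℕ → Term Sym) (t : Term Sym),
      (t.shift 1).subst (ups σ) = (t.subst σ).shift 1 := fun σ t => by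
    simp only [shift, subst_rename, rename_subst]; rfl
  induction h generalizing σ with
  | com t w r =>
    have h1 : (t.rename swap01).subst (ups (ups σ)) = (t.subst (ups (ups σ))).rename swap01 := by
      simp only [subst_rename, rename_subst]
      congr 1; funext i
      match i with
      | 0 => rfl
      | 1 => rfl
      | i + 2 =>
        simp only [swap01, ups, shift, rename_rename]
    simp only [Term.subst, hs, h1]
    exact .com _ _ _
  | atR t r w => simp only [Term.subst, hs]; exact .atR _ _ _
  | atL t r w => simp only [Term.subst, hs]; exact .atL _ _ _
  | box t w r =>
    have h1 : (t.rename (upr (fun i => i + 1))).subst (ups (ups σ))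
        = (t.subst (ups σ)).rename (upr (fun i => i + 1)) := by
      simp only [subst_rename, rename_subst]
      congr 1; funext i
      match i with
      | 0 => rfl
      | i + 1 => simp only [upr, ups, shift, rename_rename]
    simp only [Term.subst, h1]
    exact .box _ _ _
  | refl t => exact .refl _
  | symm _ ih => exact .symm (ih σ)
  | trans _ _ ih₁ ih₂ => exact .trans (ih₁ σ) (ih₂ σ)
  | appL w _ ih => exact .appL _ (ih σ)
  | appR t _ ih => exact .appR _ (ih σ)
  | esL w _ ih => exact .esL _ (ih _)
  | esR t _ ih => exact .esR _ (ih σ)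

theorem StructEq.rename {t w : Term Sym} (h : StructEq t w) (ρ : ℕ → ℕ) :
    StructEq (t.rename ρ) (w.rename ρ) := by
  rw [rename_eq_subst, rename_eq_subst]
  exact h.subst _

theorem scons_scons_swap01 (a b : Term Sym) (σ : ℕ → Term Sym) :
    (fun i => scons a (scons b σ) (swap01 i)) = scons b (scons a σ) := by
  funext i
  match i with
  | 0 => rfl
  | 1 => rfl
  | i + 2 => rfl

theorem scons_scons_upr_succ (a b : Term Sym) (σ : ℕ → Term Sym) :
    (fun i => scons a (scons b σ) (upr (fun i => i + 1) i)) = scons a σ := by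
  funext i; cases i <;> rfl

/-- The axioms only rearrange substitutions whose execution gives the same term. Consequently all
fireball tests agree on equivalent terms. -/
theorem StructEq.unfIn_eq {t w : Term Sym} (h : StructEq t w) (σ : ℕ → Term Sym) :
    unfIn σ t = unfIn σ w := by
  induction h generalizing σ with
  | com t w r => simp [scons_scons_swap01]
  | atR t r w => simp
  | atL t r w => simp
  | box t w r => simp [scons_scons_upr_succ]
  | refl t => rfl
  | symm _ ih => exact (ih σ).symm
  | trans _ _ ih₁ ih₂ => exact (ih₁ σ).trans (ih₂ σ)
  | appL w _ ih => simp [ih σ]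
  | appR t _ ih => simp [ih σ]
  | esL w _ ih => simp [ih]
  | esR t _ ih => simp [ih σ]

/-- The term is `L⟨v⟩` where `v` is not an application. -/
def NotApp : Term Sym → Prop
  | .es t _ => NotApp t
  | .app _ _ => False
  | _ => True

theorem notApp_rename (t : Term Sym) (ρ : ℕ → ℕ) : NotApp (t.rename ρ) ↔ NotApp t := by
  induction t generalizing ρ <;> simp_all [NotApp, Term.rename]

theorem StructEq.notApp_iff {t w : Term Sym} (h : StructEq t w) : NotApp t ↔ NotApp w := by
  induction h <;> simp_all [NotApp, notApp_rename]

theorem NotApp.of_isValue {σ : ℕ → Term Sym} {t : Term Sym} (h : (unfIn σ t).IsValue) :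
    NotApp t := by
  induction t generalizing σ with
  | app t w => obtain ⟨b, hb⟩ := h; simp at hb
  | es t w iht ihw => rw [unfIn_es] at h; exact iht h
  | _ => trivial

-- Structural equivalence and operations under substitution contexts

/-- `com` and `box` rearrange the substitutions around the core `v`, and naturality makes `F` follow
the renaming. `atL` and `atR` would change the core itself, but only around an application, which
`NotApp` excludes. -/
theorem StructEq.push {F : (ℕ → ℕ) → Term Sym → Term Sym} (hF : Natural F) {t w : Term Sym}
    (h : StructEq t w) (ht : NotApp t) (ρ : ℕ → ℕ) : StructEq (push F ρ t) (push F ρ w) := by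
  induction h generalizing ρ with
  | com t w r =>
    have : Term.push F (fun i => ρ i + 1 + 1) (t.rename swap01)
        = (Term.push F (fun i => ρ i + 1 + 1) t).rename swap01 := by
      rw [push_rename hF]; rfl
    simp only [Term.push, this]
    exact .com _ _ _
  | atR t r w => exact ht.elim
  | atL t r w => exact ht.elim
  | box t w r =>
    have : Term.push F (fun i => ρ i + 1 + 1) (t.rename (upr fun i => i + 1))
        = (Term.push F (fun i => ρ i + 1) t).rename (upr fun i => i + 1) := by
      rw [push_rename hF]; rfl
    simp only [Term.push, this]
    exact .box _ _ _
  | refl t => exact .refl _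
  | symm h ih => exact .symm (ih (h.notApp_iff.2 ht) ρ)
  | trans h _ ih₁ ih₂ => exact .trans (ih₁ ht ρ) (ih₂ (h.notApp_iff.1 ht) ρ)
  | appL w _ ih => exact ht.elim
  | appR t _ ih => exact ht.elim
  | esL w _ ih => exact .esL _ (ih ht _)
  | esR t h ih => exact .esR _ h

theorem StructEq.push_fun {F G : (ℕ → ℕ) → Term Sym → Term Sym} (ρ : ℕ → ℕ) (t : Term Sym)
    (h : ∀ (k : ℕ) v, StructEq (F (fun i => ρ i + k) v) (G (fun i => ρ i + k) v)) :
    StructEq (Term.push F ρ t) (Term.push G ρ t) := by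
  induction t generalizing ρ with
  | es t w iht ihw =>
    simp only [Term.push]
    refine .esL _ (iht _ fun k v => ?_)
    have := h (1 + k) v
    simpa only [Nat.add_assoc] using this
  | _ => exact h 0 _

/-- Iterating `atR` extrudes the whole substitution context of the argument. The next two lemmas do
the same with `atL` for the function part and with `com` for the body of a substitution. -/
theorem structEq_app_push (t w : Term Sym) (F : (ℕ → ℕ) → Term Sym → Term Sym) (ρ : ℕ → ℕ) :
    StructEq (.app (t.rename ρ) (push F ρ w)) (push (fun ρ v => .app (t.rename ρ) (F ρ v)) ρ w) := by
  induction w generalizing ρ with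
  | es w r ihw ihr =>
    refine .trans (.symm (.atR _ _ _)) (.esL _ ?_)
    rw [shift, rename_rename]
    exact ihw _
  | _ => exact .refl _

theorem structEq_push_app (w r : Term Sym) (F : (ℕ → ℕ) → Term Sym → Term Sym) (ρ : ℕ → ℕ) :
    StructEq (.app (push F ρ w) (r.rename ρ)) (push (fun ρ v => .app (F ρ v) (r.rename ρ)) ρ w) := by
  induction w generalizing ρ with
  | es w r' ihw ihr =>
    refine .trans (.symm (.atL _ _ _)) (.esL _ ?_)
    rw [shift, rename_rename]
    exact ihw _
  | _ => exact .refl _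

theorem structEq_es_push {F : (ℕ → ℕ) → Term Sym → Term Sym} (hF : Natural F) (w r : Term Sym)
    (ρ : ℕ → ℕ) : StructEq (.es (push F (upr ρ) (w.shift 1)) (r.rename ρ))
      (push (fun ρ v => .es (F (upr ρ) (v.shift 1)) (r.rename ρ)) ρ w) := by
  induction w generalizing ρ with
  | es w r' ihw ihr =>
    have h : (push F (fun i => upr ρ i + 1) (w.rename (upr fun i => i + 1))).rename swap01
        = push F (upr fun i => ρ i + 1) (w.shift 1) := by
      rw [push_rename hF, rename_rename]
      congr 1
      · funext i; cases i <;> rfl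
      · rw [shift]; congr 1; funext i; cases i <;> rfl
    refine .trans (.com _ _ _) (.esL _ ?_)
    rw [h]
    have := ihw (fun i => ρ i + 1)
    rwa [← rename_rename r ρ (fun i => i + 1)] at this
  | _ => exact .refl _

/-- Structural equivalence of outcomes. -/
inductive Outcome.Equiv : Outcome Sym → Outcome Sym → Prop
  | none : Outcome.Equiv .none .none
  | abs : Outcome.Equiv .abs .abs
  | step (k : RuleKind) {t t' : Term Sym} :
      StructEq t t' → Outcome.Equiv (.step k t) (.step k t')
  | head (i : ℕ) {P P' : Term Sym} : StructEq P P' → Outcome.Equiv (.head i P) (.head i P')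

namespace Outcome.Equiv

theorem refl (o : Outcome Sym) : o.Equiv o := by
  cases o with
  | none => exact .none
  | abs => exact .abs
  | step k t => exact .step k (.refl t)
  | head i P => exact .head i (.refl P)

theorem symm {o o' : Outcome Sym} (h : o.Equiv o') : o'.Equiv o := by
  cases h with
  | none => exact .none
  | abs => exact .abs
  | step k h => exact .step k h.symm
  | head i h => exact .head i h.symm

theorem trans {o₁ o₂ o₃ : Outcome Sym} (h : o₁.Equiv o₂) (h' : o₂.Equiv o₃) : o₁.Equiv o₃ := by
  cases h with
  | none => exact h'
  | abs => exact h'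
  | step k h => cases h' with | step _ h' => exact .step k (h.trans h')
  | head i h => cases h' with | head _ h' => exact .head i (h.trans h')

end Outcome.Equiv

theorem structEq_fireExp {P P' : Term Sym} (h : StructEq P P') (ρ : ℕ → ℕ) (v : Term Sym) :
    StructEq (fireExp P ρ v) (fireExp P' ρ v) := .esL _ (h.subst _)

theorem structEq_fireMul {w w' : Term Sym} (h : StructEq w w') (ρ : ℕ → ℕ) (v : Term Sym) :
    StructEq (fireMul w ρ v) (fireMul w' ρ v) := by
  cases v <;> exact .esR _ (h.rename ρ)

theorem Outcome.Equiv.es {o o' : Outcome Sym} (h : o.Equiv o') (w : Term Sym) :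
    (o.es w).Equiv (o'.es w) := by
  cases h with
  | none => exact .none
  | abs => exact .abs
  | step k h => exact .step k (.esL _ h)
  | head i h =>
    cases i with
    | zero => exact .step _ (StructEq.push_fun _ _ fun k v => structEq_fireExp h _ v)
    | succ i => exact .head i (.esL _ (h.rename _))

theorem Outcome.Equiv.appR {o o' : Outcome Sym} (h : o.Equiv o') (t : Term Sym) :
    (o.appR t).Equiv (o'.appR t) := by
  cases h with
  | none => exact .none
  | abs => exact .none
  | step k h => exact .step k (.appR _ h)
  | head i h => exact .head i (.appR _ h)

theorem Outcome.appR_equiv {t t' : Term Sym} (h : StructEq t t') (o : Outcome Sym) :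
    (o.appR t).Equiv (o.appR t') := by
  cases o with
  | none => exact .none
  | abs => exact .none
  | step k w => exact .step k (.appL _ h)
  | head i P => exact .head i (.appL _ (h.rename _))

/-! ## Invariance of the redex under structural equivalence -/

/-- On the left `[x←w]` fires inside the scope of `[y←r]`; on the right `[y←r]` is part of the
marked body on which `[x←w]` fires. The two exchanges turn the order marker, `x`, `y` into `y`,
marker, `x`. -/
theorem structEq_es_push_fireExp (P w r : Term Sym) :
    StructEq (.es (push (fireExp P) (fun i => i) (w.shift 1)) r)
      (push (fireExp (.es ((P.rename (upr swap01)).rename swap01) ((r.shift 1).shift 1)))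
        (fun i => i) w) := by
  have h := structEq_es_push (natural_fireExp P) w r (fun i => i)
  rw [upr_id, rename_id] at h
  refine h.trans (StructEq.push_fun _ _ fun k v => (StructEq.com _ _ _).trans (.of_eq ?_))
  simp only [fireExp, Term.subst, rename_subst, subst_rename, shift]
  congr 2
  · congr 1; funext i
    match i with
    | 0 => simp [expEnv, shift, rename_rename, upr, swap01, ups]
    | 1 => rfl
    | 2 => rfl
    | i + 3 => rfl
  · rw [rename_rename, rename_eq_subst]; rfl

theorem redex_com (σ : ℕ → Term Sym) (b : Bool) (t w r : Term Sym)
    (hw : (unfIn σ w).IsFireball) (hr : (unfIn σ r).IsFireball) :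
    (redex σ b (.es (.es t (w.shift 1)) r)).Equiv
      (redex σ b (.es (.es (t.rename swap01) (r.shift 1)) w)) := by
  rw [redex_es_pos hr, redex_es_pos (by rwa [unfIn_shift_one]), redex_es_pos hw,
    redex_es_pos (by rwa [unfIn_shift_one]), unfIn_shift_one, unfIn_shift_one, redex_rename,
    scons_scons_swap01]
  rcases redex (scons (unfIn σ w) (scons (unfIn σ r) σ)) b t with
    _ | _ | ⟨k, t'⟩ | ⟨_ | _ | i, P⟩
  · exact .none
  · exact .abs
  · exact .step k (.com _ _ _)
  · exact .step _ (structEq_es_push_fireExp P w r)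
  -- The substitution of `r` fires: the previous case with the two substitutions in exchanged roles,
  -- where the exchanges cancel.
  · refine .step _ (.symm (.trans (structEq_es_push_fireExp _ r w) (.of_eq ?_)))
    rw [rename_rename (P) (upr swap01) (upr swap01), upr_comp]
    simp only [swap01_swap01, upr_id, rename_id]
  · have h : ∀ v : Term Sym, ((v.shift 1).shift 1).rename swap01 = (v.shift 1).shift 1 :=
      fun v => by simp only [shift, rename_rename]; rfl
    have h' : (((P.rename swap01).rename (upr swap01)).rename swap01)
        = (((P.rename (upr swap01)).rename swap01).rename (upr swap01)) := by
      simp only [rename_rename]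
      congr 1; funext i
      match i with
      | 0 => rfl
      | 1 => rfl
      | 2 => rfl
      | i + 3 => rfl
    refine .head _ ?_
    simp only [Term.rename, h, ← h']
    exact .com _ _ _

theorem redex_atR (σ : ℕ → Term Sym) (b : Bool) (t r w : Term Sym)
    (hw : (unfIn σ w).IsFireball) :
    (redex σ b (.es (.app (t.shift 1) r) w)).Equiv (redex σ b (.app t (.es r w))) := by
  by_cases hr : (unfIn (scons (unfIn σ w) σ) r).IsFireball
  · rw [redex_es_pos hw, redex_app_pos hr, redex_app_pos (by rwa [unfIn_es]), shift, redex_rename]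
    simp only [scons_succ]
    rcases redex σ true t with _ | _ | ⟨k, t'⟩ | ⟨i, P⟩
    · exact .none
    · refine .step _ ?_
      have h := structEq_es_push (natural_fireMul r) t w (fun i => i)
      rw [upr_id, rename_id] at h
      refine h.trans (StructEq.push_fun _ _ fun k v => ?_)
      -- Once extruded, the terms differ by a `box`: `w` enters the argument of the substitution
      -- just created. The value of `fireMul` on other terms than abstractions was chosen so that
      -- this remains true there.
      have hr' : ∀ v : Term Sym, (v.shift 1).shift 1 = (v.shift 1).rename (upr fun i => i + 1) :=
        fun v => by simp only [shift, rename_rename]; rfl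
      cases v with
      | lam c => exact .box _ _ _
      | var j => exact .box (var (j + 1)) _ _
      | sym a => exact .box (sym a) _ _
      | app p q =>
        simp only [fireMul, shift, Term.rename]
        have := hr' (app p q)
        simp only [shift, Term.rename] at this
        rw [this]
        exact .box (app _ _) _ _
      | es p q =>
        simp only [fireMul, shift, Term.rename]
        have := hr' (.es p q)
        simp only [shift, Term.rename] at this
        rw [this]
        exact .box (.es _ _) _ _
    · exact .step k (.atR _ _ _)
    · refine .head i (.trans (.of_eq ?_) (.atR _ _ _))
      simp only [Term.rename, rename_rename, shift]
      congr 3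
      all_goals funext i; cases i <;> rfl
  · rw [redex_es_pos hw, redex_app_neg hr, redex_app_neg (by rwa [unfIn_es]), redex_es_pos hw]
    rcases redex (scons (unfIn σ w) σ) false r with _ | _ | ⟨k, t'⟩ | ⟨_ | i, P⟩
    · exact .none
    · exact .none
    · exact .step k (.atR _ _ _)
    · refine .step _ (.symm ?_)
      have h := structEq_app_push t w (fireExp P) (fun i => i)
      rw [rename_id] at h
      refine h.trans (StructEq.push_fun _ _ fun k v =>
        (StructEq.symm (.atR _ _ _)).trans (.of_eq ?_))
      simp only [fireExp, Term.subst, shift, rename_rename, subst_rename]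
      rw [rename_eq_subst]; rfl
    · refine .head i (.trans (.of_eq ?_) (.atR _ _ _))
      simp only [Term.rename, rename_rename, shift]
      rfl

theorem redex_atL (σ : ℕ → Term Sym) (b : Bool) (t r w : Term Sym)
    (hw : (unfIn σ w).IsFireball) :
    (redex σ b (.es (.app t (r.shift 1)) w)).Equiv (redex σ b (.app (.es t w) r)) := by
  by_cases hr : (unfIn σ r).IsFireball
  · rw [redex_es_pos hw, redex_app_pos (by rwa [unfIn_shift_one]), redex_app_pos hr,
      redex_es_pos hw]
    rcases redex (scons (unfIn σ w) σ) true t with _ | _ | ⟨k, t'⟩ | ⟨_ | i, P⟩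
    · exact .none
    · refine .step _ (.of_eq ?_)
      simp only [push]
      congr 1
      refine push_congr_fun _ _ _ fun k v => ?_
      have : ∀ ρ, (r.shift 1).rename ρ = r.rename (fun i => ρ (i + 1)) := fun ρ => by
        rw [shift, rename_rename]
      cases v <;> simp only [fireMul, this]
    · exact .step k (.atL _ _ _)
    · refine .step _ (.symm ?_)
      have h := structEq_push_app w r (fireExp P) (fun i => i)
      rw [rename_id] at h
      refine h.trans (StructEq.push_fun _ _ fun k v =>
        (StructEq.symm (.atL _ _ _)).trans (.of_eq ?_))
      simp only [fireExp, Term.subst, shift, rename_rename, subst_rename]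
      rw [rename_eq_subst r]; rfl
    · refine .head i (.trans (.of_eq ?_) (.atL _ _ _))
      simp only [Term.rename, rename_rename, shift]
      rfl
  · rw [redex_es_pos hw, redex_app_neg (by rwa [unfIn_shift_one]), redex_app_neg hr, shift,
      redex_rename]
    simp only [scons_succ]
    rcases redex σ false r with _ | _ | ⟨k, t'⟩ | ⟨i, P⟩
    · exact .none
    · exact .none
    · exact .step k (.atL _ _ _)
    · refine .head i (.trans (.of_eq ?_) (.atL _ _ _))
      simp only [Term.rename, rename_rename, shift]
      congr 3
      all_goals funext i; cases i <;> rfl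

/-- When `x` is replaced, `[y←r]` belongs to the substitution context of the content `w[y←r]`, so
both sides reduce to the same term. -/
theorem redex_box (σ : ℕ → Term Sym) (b : Bool) (t w r : Term Sym)
    (hw : (unfIn (scons (unfIn σ r) σ) w).IsFireball) (hr : (unfIn σ r).IsFireball) :
    (redex σ b (.es (.es (t.rename (upr (fun i => i + 1))) w) r)).Equiv
      (redex σ b (.es t (.es w r))) := by
  rw [redex_es_pos hr, redex_es_pos hw, redex_es_pos (by rwa [unfIn_es]), redex_rename,
    scons_scons_upr_succ, unfIn_es]
  rcases redex (scons (unfIn (scons (unfIn σ r) σ) w) σ) b t with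
    _ | _ | ⟨k, t'⟩ | ⟨_ | i, P⟩
  · exact .none
  · exact .abs
  · exact .step k (.box _ _ _)
  · refine .step _ (.of_eq ?_)
    simp only [push]
    congr 1
    refine push_congr_fun _ _ _ fun k v => ?_
    simp only [fireExp, subst_rename]
    congr 2; funext i
    match i with
    | 0 => rfl
    | 1 => rfl
    | i + 2 => simp only [expEnv, upr, scons_succ]
  · refine .head i (.trans (.of_eq ?_) (.box _ _ _))
    simp only [Term.rename, rename_rename, shift]
    congr 3
    · funext i
      match i with
      | 0 => rfl
      | 1 => rfl
      | i + 2 => rfl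
    · funext i; cases i <;> rfl

/-! ## The invariant of reachable terms -/

/-- In the environment `σ`, abstractions have no explicit substitution in their bodies, and the
explicit substitutions outside abstractions contain terms that unfold to fireballs. -/
def WellFormed : (ℕ → Term Sym) → Term Sym → Prop
  | _, .var _ => True
  | _, .sym _ => True
  | _, .lam t => t.ESFree
  | σ, .app t w => WellFormed σ t ∧ WellFormed σ w
  | σ, .es t w => WellFormed σ w ∧ (unfIn σ w).IsFireball ∧ WellFormed (scons (unfIn σ w) σ) t

theorem ESFree.wellFormed {t : Term Sym} (h : t.ESFree) (σ : ℕ → Term Sym) : WellFormed σ t := by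
  induction t with
  | var i => trivial
  | sym a => trivial
  | lam t ih => exact h
  | app t w iht ihw => exact ⟨iht h.1, ihw h.2⟩
  | es t w iht ihw => exact h.elim

theorem esFree_rename_iff (t : Term Sym) (ρ : ℕ → ℕ) : (t.rename ρ).ESFree ↔ t.ESFree := by
  induction t generalizing ρ <;> simp_all [ESFree, Term.rename]

theorem wellFormed_rename (σ : ℕ → Term Sym) (ρ : ℕ → ℕ) (t : Term Sym) :
    WellFormed σ (t.rename ρ) ↔ WellFormed (fun i => σ (ρ i)) t := by
  induction t generalizing σ ρ <;>
    simp_all [WellFormed, Term.rename, esFree_rename_iff, scons_comp_upr]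

theorem wellFormed_shift_one (a : Term Sym) (σ : ℕ → Term Sym) (t : Term Sym) :
    WellFormed (scons a σ) (t.shift 1) ↔ WellFormed σ t := by
  rw [shift, wellFormed_rename]; rfl

theorem WellFormed.subst {σ τ : ℕ → Term Sym} {t : Term Sym}
    (h : WellFormed (fun i => unfIn σ (τ i)) t) (hτ : ∀ i, (τ i).ESFree) :
    WellFormed σ (t.subst τ) := by
  induction t generalizing σ τ with
  | var i => exact ESFree.wellFormed (hτ i) σ
  | sym a => trivial
  | lam t ih => exact ESFree.subst (t := .lam t) h hτ
  | app t w iht ihw => exact ⟨iht h.1 hτ, ihw h.2 hτ⟩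
  | es t w iht ihw =>
    obtain ⟨hw, hf, ht⟩ := h
    rw [← unfIn_subst] at hf ht
    refine ⟨ihw hw hτ, hf, iht ?_ fun i => ?_⟩
    · rwa [Ctx.unfIn_ups]
    · cases i with
      | zero => trivial
      | succ n => exact (hτ n).rename _

theorem StructEq.wellFormed_iff {t w : Term Sym} (h : StructEq t w) (σ : ℕ → Term Sym) :
    WellFormed σ t ↔ WellFormed σ w := by
  induction h generalizing σ with
  | com t w r =>
    simp only [WellFormed, wellFormed_shift_one, wellFormed_rename, unfIn_shift_one,
      scons_scons_swap01]
    tauto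
  | atR t r w => simp only [WellFormed, wellFormed_shift_one]; tauto
  | atL t r w => simp only [WellFormed, wellFormed_shift_one]; tauto
  | box t w r =>
    simp only [WellFormed, wellFormed_rename, scons_scons_upr_succ, unfIn_es]
    tauto
  | refl t => rfl
  | symm _ ih => exact (ih σ).symm
  | trans _ _ ih₁ ih₂ => exact (ih₁ σ).trans (ih₂ σ)
  | appL w _ ih => simp only [WellFormed, ih]
  | appR t _ ih => simp only [WellFormed, ih]
  | esL w _ ih => simp only [WellFormed, ih]
  | esR t h ih => simp only [WellFormed, ih, h.unfIn_eq]

/-- Well-formedness makes the test of each explicit substitution outside abstractions succeed, so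
moving substitutions around never blocks or unblocks the search. What remains is to compare the
outcomes rule by rule. -/
theorem StructEq.redex_equiv {t w : Term Sym} (h : StructEq t w) (σ : ℕ → Term Sym) (b : Bool)
    (ht : WellFormed σ t) : (redex σ b t).Equiv (redex σ b w) := by
  induction h generalizing σ b with
  | com t w r =>
    simp only [WellFormed, unfIn_shift_one] at ht
    exact redex_com σ b t w r ht.2.2.2.1 ht.2.1
  | atR t r w => exact redex_atR σ b t r w ht.2.1
  | atL t r w => exact redex_atL σ b t r w ht.2.1
  | box t w r => exact redex_box σ b t w r ht.2.2.2.1 ht.2.1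
  | refl t => exact .refl _
  | symm h ih => exact .symm (ih σ b ((h.wellFormed_iff σ).2 ht))
  | trans h _ ih₁ ih₂ => exact .trans (ih₁ σ b ht) (ih₂ σ b ((h.wellFormed_iff σ).1 ht))
  | @appL t t' w h ih =>
    by_cases hw : (unfIn σ w).IsFireball
    · simp only [redex, if_pos hw]
      have ih' := ih σ true ht.1
      cases e : redex σ true t with
      | none => rw [e] at ih'; cases e' : redex σ true t' <;> rw [e'] at ih' <;> cases ih'; exact .none
      | abs =>
        rw [e] at ih'
        cases e' : redex σ true t' <;> rw [e'] at ih' <;> cases ih'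
        obtain ⟨L, p, hL, -, rfl⟩ := redex_eq_abs e
        -- Here `t` is an abstraction under a substitution context, so it is not an application
        -- there and `push` respects the equivalence.
        refine .step _ (h.push (natural_fireMul w) ?_ _)
        clear e e' h ih ht
        induction L with
        | hole => trivial
        | es L r ihL => exact ihL hL
        | _ => exact hL.elim
      | step k p =>
        rw [e] at ih'
        cases e' : redex σ true t' <;> rw [e'] at ih' <;> cases ih'
        rename_i h'
        exact .step k (.appL _ h')
      | head i P =>
        rw [e] at ih'
        cases e' : redex σ true t' <;> rw [e'] at ih' <;> cases ih'
        rename_i h'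
        exact .head i (.appL _ h')
    · simp only [redex, if_neg hw]
      exact Outcome.appR_equiv h _
  | @appR w w' t h ih =>
    by_cases hw : (unfIn σ w).IsFireball
    · have hw' := hw
      rw [h.unfIn_eq] at hw'
      simp only [redex, if_pos hw, if_pos hw']
      cases redex σ true t with
      | none => exact .none
      | abs => exact .step _ (StructEq.push_fun _ _ fun k v => structEq_fireMul h _ v)
      | step k p => exact .step k (.appR _ h)
      | head i P => exact .head i (.appR _ (h.rename _))
    · have hw' := hw
      rw [h.unfIn_eq] at hw'
      simp only [redex, if_neg hw, if_neg hw']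
      exact (ih σ false ht.2).appR t
  | esL w h ih =>
    have hw := ht.2.1
    simp only [redex, if_pos hw]
    exact (ih _ b ht.2.2).es w
  | @esR w w' t h ih =>
    have hw := ht.2.1
    have hw' := hw
    rw [h.unfIn_eq] at hw'
    simp only [redex, if_pos hw, if_pos hw', ← h.unfIn_eq]
    rcases e : redex (scons (unfIn σ w) σ) b t with _ | _ | ⟨k, t'⟩ | ⟨_ | i, P⟩
    · exact .none
    · exact .abs
    · exact .step k (.esR _ h)
    · exact .step _ (h.push (natural_fireExp P) (NotApp.of_isValue (redex_eq_head e).1) _)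
    · exact .head i (.esR _ (h.rename _))

/-! ### Preservation of the invariant -/

/-- `σ'` is the environment below the substitutions already crossed, and `ρ` embeds the outer
variables, seen by `w`, into it. -/
theorem WellFormed.push_fireMul {σ σ' : ℕ → Term Sym} {t w : Term Sym} {ρ : ℕ → ℕ}
    (hσ : (fun i => σ' (ρ i)) = σ) (ht : WellFormed σ' t) (hw : WellFormed σ w)
    (hf : (unfIn σ w).IsFireball) : WellFormed σ' (push (fireMul w) ρ t) := by
  have hw' : WellFormed σ' (w.rename ρ) := by rwa [wellFormed_rename, hσ]
  have hf' : (unfIn σ' (w.rename ρ)).IsFireball := by rwa [unfIn_rename, hσ]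
  induction t generalizing σ' ρ with
  | es t r iht ihr =>
    refine ⟨ht.1, ht.2.1, iht hσ ht.2.2 ?_ ?_⟩
    · rw [wellFormed_rename] at hw' ⊢
      exact hw'
    · rw [unfIn_rename] at hf' ⊢
      exact hf'
  | lam t => exact ⟨hw', hf', ESFree.wellFormed ht _⟩
  | _ => exact ⟨hw', hf', (wellFormed_shift_one _ _ _).2 ht⟩

theorem WellFormed.push_fireExp {σ σ' : ℕ → Term Sym} {P w a : Term Sym} {ρ : ℕ → ℕ}
    (hσ : (fun i => σ' (ρ i)) = σ) (hw : WellFormed σ' w) (ha : unfIn σ' w = a) (hv : a.IsValue)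
    (hP : WellFormed (scons a (scons a σ)) P) : WellFormed σ' (push (fireExp P) ρ w) := by
  -- At the core of the substitution context `v` unfolds to the value `a`. Filling the marker with
  -- it leaves the environment of `P` unchanged, since marker and substituted variable both denote
  -- `a`. The core is not an application, so it is free of explicit substitutions and can be copied
  -- anywhere.
  have key : ∀ {σ' : ℕ → Term Sym} {ρ : ℕ → ℕ} {v : Term Sym}, (fun i => σ' (ρ i)) = σ →
      WellFormed σ' v → v.ESFree → unfIn σ' v = a → WellFormed σ' (fireExp P ρ v) := by
    intro σ' ρ v hσ h1 h2 h3
    refine ⟨h1, ?_, WellFormed.subst ?_ fun i => ?_⟩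
    · obtain ⟨b, rfl⟩ := hv
      rw [h3]
      exact .value b
    · convert hP using 1
      funext i
      match i with
      | 0 => simp [expEnv, h3]
      | 1 => simp [expEnv, h3]
      | i + 2 => simp [expEnv, ← hσ]
    · match i with
      | 0 => exact h2.rename _
      | 1 => trivial
      | i + 2 => trivial
  induction w generalizing σ' ρ with
  | es t r iht ihr => exact ⟨hw.1, hw.2.1, iht hσ hw.2.2 (by rwa [unfIn_es] at ha)⟩
  | app t r =>
    obtain ⟨b, rfl⟩ := hv
    cases ha
  | var i => exact key hσ hw trivial ha
  | sym c => exact key hσ hw trivial ha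
  | lam t => exact key hσ hw hw ha

/-- The invariant for outcomes. -/
def Outcome.WellFormed (σ : ℕ → Term Sym) : Outcome Sym → Prop
  | .step _ t => Glamour.WellFormed σ t
  | .head i P => Glamour.WellFormed (scons (σ i) σ) P
  | _ => True

theorem WellFormed.redex {σ : ℕ → Term Sym} {t : Term Sym} (h : WellFormed σ t) (b : Bool) :
    (redex σ b t).WellFormed σ := by
  induction t generalizing σ b with
  | var i => simp only [Glamour.redex]; split_ifs <;> trivial
  | sym a => trivial
  | lam t => simp only [Glamour.redex]; split_ifs <;> trivial
  | app t w iht ihw =>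
    by_cases hw : (unfIn σ w).IsFireball
    · simp only [Glamour.redex, if_pos hw]
      have := iht h.1 true
      cases e : Glamour.redex σ true t with
      | none => trivial
      | abs => exact WellFormed.push_fireMul rfl h.1 h.2 hw
      | step k p => rw [e] at this; exact ⟨this, h.2⟩
      | head i P => rw [e] at this; exact ⟨this, (wellFormed_shift_one _ _ _).2 h.2⟩
    · simp only [Glamour.redex, if_neg hw]
      have := ihw h.2 false
      cases e : Glamour.redex σ false w with
      | none => trivial
      | abs => trivial
      | step k p => rw [e] at this; exact ⟨h.1, this⟩
      | head i P => rw [e] at this; exact ⟨(wellFormed_shift_one _ _ _).2 h.1, this⟩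
  | es t w iht ihw =>
    obtain ⟨hw, hf, ht⟩ := h
    simp only [Glamour.redex, if_pos hf]
    have := iht ht b
    rcases e : Glamour.redex (scons (unfIn σ w) σ) b t with _ | _ | ⟨k, t'⟩ | ⟨_ | i, P⟩ <;>
      rw [e] at this
    · trivial
    · trivial
    · exact ⟨hw, hf, this⟩
    · exact WellFormed.push_fireExp rfl hw rfl (redex_eq_head e).1 this
    · refine ⟨(wellFormed_shift_one _ _ _).2 hw, by rwa [unfIn_shift_one], ?_⟩
      rw [wellFormed_rename, unfIn_shift_one, scons_scons_swap01]
      exact this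

theorem WellFormed.uStep {k : RuleKind} {t t' : Term Sym} (h : WellFormed .var t)
    (hs : UStep k t t') : WellFormed .var t' := by
  have := h.redex false
  rwa [hs.redex_eq] at this

theorem StructEq.bisimulation {k : RuleKind} {t w t' : Term Sym} (ht : WellFormed .var t)
    (h : StructEq t w) (hs : UStep k t t') : ∃ w', UStep k w w' ∧ StructEq t' w' := by
  have := h.redex_equiv .var false ht
  rw [hs.redex_eq] at this
  cases e : redex .var false w <;> rw [e] at this <;> cases this
  rename_i h'
  exact ⟨_, (uStep_iff_redex _ _ _).2 e, h'⟩

/-! ## Codes and their names -/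

/-- The index of a name in the scope of the binders `Γ`. -/
def nameIdx (Γ : List ℕ) (x : ℕ) : ℕ := if x ∈ Γ then Γ.idxOf x else Γ.length + x

theorem nameIdx_cons (y : ℕ) (Γ : List ℕ) (x : ℕ) :
    nameIdx (y :: Γ) x = if x = y then 0 else nameIdx Γ x + 1 := by
  by_cases h : x = y
  · subst h; simp [nameIdx]
  · have h' : (y == x) = false := by simpa using Ne.symm h
    by_cases hx : x ∈ Γ
    · simp [nameIdx, h, hx, List.idxOf_cons, h']
    · simp [nameIdx, h, hx]; omega

theorem nameIdx_append {Γ Δ : List ℕ} {x : ℕ} (h : x ∉ Δ) :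
    nameIdx (Δ ++ Γ) x = nameIdx Γ x + Δ.length := by
  induction Δ with
  | nil => rfl
  | cons y Δ ih =>
    simp only [List.mem_cons, not_or] at h
    simp [nameIdx_cons, h.1, ih h.2]; omega

namespace Code

/-- The name `x` occurs free in the code. -/
def Free (x : ℕ) : Code Sym → Prop
  | var y => x = y
  | sym _ => False
  | lam y t => x ≠ y ∧ t.Free x
  | app t w => t.Free x ∨ w.Free x

def Scoped (Γ : List ℕ) (c : Code Sym) : Prop := ∀ x, c.Free x → x ∈ Γ

theorem Scoped.mono {Γ Γ' : List ℕ} {c : Code Sym} (h : c.Scoped Γ) (hΓ : Γ ⊆ Γ') :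
    c.Scoped Γ' := fun x hx => hΓ (h x hx)

theorem toTerm_var (Γ : List ℕ) (x : ℕ) :
    (var x : Code Sym).toTerm Γ = .var (nameIdx Γ x) := rfl

/-- Only the names free in the code matter when its scope changes; binders extend both scopes alike.
-/
theorem toTerm_rename {Γ Γ' : List ℕ} {ρ : ℕ → ℕ} {c : Code Sym}
    (h : ∀ x, c.Free x → nameIdx Γ' x = ρ (nameIdx Γ x)) :
    c.toTerm Γ' = (c.toTerm Γ).rename ρ := by
  induction c generalizing Γ Γ' ρ with
  | var x => rw [toTerm_var, toTerm_var, h x rfl]; rfl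
  | sym a => rfl
  | lam y t ih =>
    simp only [toTerm, Term.rename]
    rw [ih]
    intro x hx
    simp only [nameIdx_cons]
    split_ifs with hxy
    · rfl
    · rw [h x ⟨hxy, hx⟩]; rfl
  | app t w iht ihw =>
    simp only [toTerm, Term.rename]
    rw [iht fun x hx => h x (.inl hx), ihw fun x hx => h x (.inr hx)]

theorem AlphaEq.toTerm_eq {c c' : Code Sym} (h : c.AlphaEq c') (Γ : List ℕ) :
    c.toTerm Γ = c'.toTerm Γ := by
  -- In the empty scope a name is its own index, so reading in `Γ` is a renaming of the reading in
  -- the empty scope.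
  have : ∀ c : Code Sym, c.toTerm Γ = (c.toTerm []).rename (nameIdx Γ) := fun c =>
    toTerm_rename fun x _ => by simp [nameIdx]
  rw [this c, this c', h]

theorem closedAt_toTerm_iff (Γ : List ℕ) (c : Code Sym) :
    (c.toTerm Γ).ClosedAt Γ.length ↔ c.Scoped Γ := by
  induction c generalizing Γ with
  | var x =>
    simp only [toTerm_var, ClosedAt, Scoped, Free, forall_eq]
    by_cases hx : x ∈ Γ
    · simpa [nameIdx, hx] using List.idxOf_lt_length_iff.2 hx
    · simp [nameIdx, hx]
  | sym a => simp [toTerm, ClosedAt, Scoped, Free]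
  | lam y t ih =>
    have := ih (y :: Γ)
    simp only [List.length_cons] at this
    simp only [toTerm, ClosedAt, this, Scoped, Free, List.mem_cons]
    refine forall_congr' fun x => ?_
    tauto
  | app t w iht ihw =>
    simp only [toTerm, ClosedAt, iht, ihw, Scoped, Free]
    refine ⟨fun h x hx => hx.elim (h.1 x) (h.2 x), fun h => ⟨fun x hx => h x (.inl hx),
      fun x hx => h x (.inr hx)⟩⟩

theorem AlphaEq.scoped {c c' : Code Sym} (h : c.AlphaEq c') {Γ : List ℕ} (hc : c.Scoped Γ) :
    c'.Scoped Γ := by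
  rw [← closedAt_toTerm_iff] at hc ⊢
  rwa [← h.toTerm_eq]

theorem toTerm_esFree (Γ : List ℕ) (c : Code Sym) : (c.toTerm Γ).ESFree := by
  induction c generalizing Γ with
  | var x => trivial
  | sym a => trivial
  | lam y t ih => exact ih _
  | app t w iht ihw => exact ⟨iht _, ihw _⟩

theorem toTerm_ne_es (Γ : List ℕ) (c : Code Sym) (p q : Term Sym) : c.toTerm Γ ≠ .es p q := by
  cases c <;> simp [toTerm]

end Code

-- Choosing bound names: codes for given terms

theorem Term.ClosedAt.mono {t : Term Sym} {k k' : ℕ} (h : t.ClosedAt k) (hk : k ≤ k') :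
    t.ClosedAt k' := by
  induction t generalizing k k' with
  | var i => exact lt_of_lt_of_le h hk
  | sym a => trivial
  | lam t ih => exact ih h (by omega)
  | app t w iht ihw => exact ⟨iht h.1 hk, ihw h.2 hk⟩
  | es t w iht ihw => exact ⟨iht h.1 (by omega), ihw h.2 hk⟩

theorem Term.exists_closedAt (t : Term Sym) : ∃ k, t.ClosedAt k := by
  induction t with
  | var i => exact ⟨i + 1, Nat.lt_succ_self i⟩
  | sym a => exact ⟨0, trivial⟩
  | lam t ih =>
    obtain ⟨k, hk⟩ := ih
    exact ⟨k, hk.mono (Nat.le_succ k)⟩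
  | app t w iht ihw =>
    obtain ⟨k, hk⟩ := iht
    obtain ⟨l, hl⟩ := ihw
    exact ⟨max k l, hk.mono (le_max_left _ _), hl.mono (le_max_right _ _)⟩
  | es t w iht ihw =>
    obtain ⟨k, hk⟩ := iht
    obtain ⟨l, hl⟩ := ihw
    exact ⟨max k l, hk.mono (by omega), hl.mono (le_max_right _ _)⟩

/-- A term without explicit substitutions has a code with distinct bound names, all at least `n`. -/
theorem exists_code_toTerm {n₀ : ℕ} {T : Term Sym} (hT : T.ESFree) {Γ : List ℕ} {n : ℕ}
    (hn : n₀ ≤ n) (hΓ : Γ.Nodup) (hΓn : ∀ y ∈ Γ, n₀ ≤ y ∧ y < n)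
    (hcl : T.ClosedAt (Γ.length + n₀)) :
    ∃ (c : Code Sym) (m : ℕ), n ≤ m ∧ c.toTerm Γ = T ∧ c.binders.Nodup ∧
      ∀ b ∈ c.binders, n ≤ b ∧ b < m := by
  -- Names below `n₀` are reserved for free variables, and bound names are taken from `n` up to `m`;
  -- the second part of an application starts where the first one stopped.
  induction T generalizing Γ n with
  | var i =>
    by_cases hi : i < Γ.length
    · refine ⟨.var Γ[i], n, le_rfl, ?_, by simp [Code.binders], by simp [Code.binders]⟩
      simp [Code.toTerm, hΓ.idxOf_getElem]
    · refine ⟨.var (i - Γ.length), n, le_rfl, ?_, by simp [Code.binders], by simp [Code.binders]⟩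
      have : i - Γ.length ∉ Γ := fun h => by
        have := (hΓn _ h).1
        simp only [ClosedAt] at hcl
        omega
      simp only [Code.toTerm, if_neg this]
      congr 1; omega
  | sym a => exact ⟨.sym a, n, le_rfl, rfl, by simp [Code.binders], by simp [Code.binders]⟩
  | lam t ih =>
    obtain ⟨c, m, hm, hc, hnd, hb⟩ := ih hT (Γ := n :: Γ) (n := n + 1) (by omega)
      (List.nodup_cons.2 ⟨fun h => by have := (hΓn _ h).2; omega, hΓ⟩)
      (by
        intro y hy
        rcases List.mem_cons.1 hy with rfl | hy
        · omega
        · have := hΓn y hy; omega)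
      (by
        have h' : t.ClosedAt (Γ.length + n₀ + 1) := hcl
        simpa only [List.length_cons, Nat.add_right_comm] using h')
    refine ⟨.lam n c, m, by omega, by simp only [Code.toTerm, hc], ?_, ?_⟩
    · exact List.nodup_cons.2 ⟨fun h => by have := (hb _ h).1; omega, hnd⟩
    · intro b h
      rcases List.mem_cons.1 h with rfl | h
      · omega
      · have := hb b h; omega
  | app t w iht ihw =>
    obtain ⟨c, m, hm, hc, hnd, hb⟩ := iht hT.1 hn hΓ hΓn hcl.1
    obtain ⟨c', m', hm', hc', hnd', hb'⟩ := ihw hT.2 (n := m) (by omega) hΓ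
      (fun y hy => by have := hΓn y hy; omega) hcl.2
    refine ⟨.app c c', m', by omega, by simp only [Code.toTerm, hc, hc'], ?_, ?_⟩
    · refine List.Nodup.append hnd hnd' fun b h h' => ?_
      have := hb b h
      have := hb' b h'
      omega
    · intro b h
      rcases List.mem_append.1 h with h | h
      · have := hb b h; omega
      · have := hb' b h; omega
  | es t w iht ihw => exact hT.elim

theorem exists_alphaEq_fresh (w : Code Sym) (N : ℕ) :
    ∃ w' : Code Sym, w.AlphaEq w' ∧ w'.binders.Nodup ∧ ∀ b ∈ w'.binders, N ≤ b := by
  obtain ⟨k, hk⟩ := (w.toTerm []).exists_closedAt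
  -- The bound `k` avoids capture of free variables, and `N` is the freshness required.
  obtain ⟨c, m, -, hc, hnd, hb⟩ := exists_code_toTerm (n₀ := max k N) (w.toTerm_esFree [])
    (Γ := []) (n := max k N) le_rfl List.nodup_nil (by simp)
    (hk.mono (by simp))
  exact ⟨c, hc.symm, hnd, fun b h => (le_max_right k N).trans (hb b h).1⟩

/-! ## Invariants of the machine -/

mutual
/-- Items with the label `l`, in the scope of the environment `E`. -/
inductive ItemOK (E : Env Sym) : Item Sym → Label → Prop
  | lam {x : ℕ} {t : Code Sym} : (Code.lam x t).Scoped E.names → ItemOK E (.code (.lam x t)) .val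
  | var {x : ℕ} {φ : Item Sym} : (x, φ, Label.val) ∈ E → ItemOK E (.code (.var x)) .val
  | sym {a : Sym} {π : Stack Sym} : StackOK E π → ItemOK E (.pair (.sym a) π) .inert
  | inert {x : ℕ} {φ : Item Sym} {π : Stack Sym} : (x, φ, Label.inert) ∈ E → StackOK E π →
      ItemOK E (.pair (.var x) π) .inert
inductive StackOK (E : Env Sym) : Stack Sym → Prop
  | nil : StackOK E .nil
  | cons {φ : Item Sym} {l : Label} {π : Stack Sym} : ItemOK E φ l → StackOK E π →
      StackOK E (.cons φ l π)
end

/-- An entry refers only to the entries after it, which are its scope in the decoding. -/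
def EnvOK : Env Sym → Prop
  | [] => True
  | (_, φ, l) :: E => ItemOK E φ l ∧ EnvOK E

def DumpOK (E : Env Sym) (D : Dump Sym) : Prop :=
  ∀ d ∈ D, d.1.Scoped E.names ∧ StackOK E d.2

/-- The invariant of reachable states. -/
structure Config.OK (s : Config Sym) : Prop where
  env : EnvOK s.env
  dump : DumpOK s.env s.dump
  code : s.code.Scoped s.env.names
  stack : StackOK s.env s.stack

theorem Env.mem_names {E : Env Sym} {x : ℕ} {φ : Item Sym} {l : Label} (h : (x, φ, l) ∈ E) :
    x ∈ E.names := List.mem_map.2 ⟨_, h, rfl⟩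

theorem Env.names_subset {E E' : Env Sym} (h : E ⊆ E') : E.names ⊆ E'.names :=
  List.map_subset _ h

mutual
theorem ItemOK.mono {E E' : Env Sym} (h : E ⊆ E') : {φ : Item Sym} → {l : Label} →
    ItemOK E φ l → ItemOK E' φ l
  | _, _, .lam hs => .lam (hs.mono (Env.names_subset h))
  | _, _, .var hx => .var (h hx)
  | _, _, .sym hπ => .sym (hπ.mono h)
  | _, _, .inert hx hπ => .inert (h hx) (hπ.mono h)
theorem StackOK.mono {E E' : Env Sym} (h : E ⊆ E') : {π : Stack Sym} →
    StackOK E π → StackOK E' π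
  | _, .nil => .nil
  | _, .cons hφ hπ => .cons (hφ.mono h) (hπ.mono h)
end

theorem DumpOK.mono {E E' : Env Sym} (h : E ⊆ E') {D : Dump Sym} (hD : DumpOK E D) :
    DumpOK E' D := fun d hd => ⟨(hD d hd).1.mono (Env.names_subset h), (hD d hd).2.mono h⟩

theorem EnvOK.of_append {E₁ E₂ : Env Sym} (h : EnvOK (E₁ ++ E₂)) : EnvOK E₂ := by
  induction E₁ with
  | nil => exact h
  | cons e E₁ ih => exact ih h.2

theorem ItemOK.code_scoped {E : Env Sym} {w : Code Sym} {l : Label} (h : ItemOK E (.code w) l) :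
    w.Scoped E.names := by
  cases h with
  | lam hs => exact hs
  | var hx =>
    intro y hy
    cases hy
    exact Env.mem_names hx

theorem Config.OK.trans {s s' : Config Sym} (h : s.OK) {l : Tr} (ht : Trans l s s') : s'.OK := by
  obtain ⟨hE, hD, hc, hπ⟩ := h
  cases ht with
  | c1 D t w π E =>
    refine ⟨hE, ?_, fun x hx => hc x (.inr hx), .nil⟩
    intro d hd
    rcases List.mem_cons.1 hd with rfl | hd
    · exact ⟨fun x hx => hc x (.inl hx), hπ⟩
    · exact hD d hd
  | um D x t φ l π E =>
    cases hπ with | cons hφ hπ => ?_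
    have hs : E ⊆ (x, φ, l) :: E := List.subset_cons_self _ _
    refine ⟨⟨hφ, hE⟩, hD.mono hs, fun y hy => ?_, hπ.mono hs⟩
    by_cases hxy : y = x
    · exact List.mem_cons.2 (.inl hxy)
    · exact List.mem_cons.2 (.inr (hc y ⟨hxy, hy⟩))
  | c2 D t π x w E =>
    exact ⟨hE, fun d hd => hD d (List.mem_cons_of_mem _ hd), (hD _ List.mem_cons_self).1,
      .cons (.lam hc) (hD _ List.mem_cons_self).2⟩
  | c3 D t π a π' E =>
    exact ⟨hE, fun d hd => hD d (List.mem_cons_of_mem _ hd), (hD _ List.mem_cons_self).1,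
      .cons (.sym hπ) (hD _ List.mem_cons_self).2⟩
  | c4 D t π x π' φ E₁ E₂ =>
    exact ⟨hE, fun d hd => hD d (List.mem_cons_of_mem _ hd), (hD _ List.mem_cons_self).1,
      .cons (.inert (φ := φ) (by simp) hπ) (hD _ List.mem_cons_self).2⟩
  | c5 D t π x w E₁ E₂ =>
    exact ⟨hE, fun d hd => hD d (List.mem_cons_of_mem _ hd), (hD _ List.mem_cons_self).1,
      .cons (.var (φ := .code w) (by simp)) (hD _ List.mem_cons_self).2⟩
  | ue D x w w' φ l π E₁ E₂ hw =>
    -- The copied code is scoped in the entries following that of `x`, hence in the whole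
    -- environment.
    refine ⟨hE, hD, hw.scoped (Code.Scoped.mono hE.of_append.1.code_scoped ?_), hπ⟩
    refine Env.names_subset fun e he => ?_
    simp [he]

/-! ## Semantics of the labels -/

namespace Env

/-- The environment of unfolded terms denoted by an environment of the machine. -/
def values (E : Env Sym) : ℕ → Term Sym := E.decode.env .var

end Env

/-- The shape of the terms with a given label. -/
def Label.Holds : Label → Term Sym → Prop
  | .val, t => t.IsValue
  | .inert, t => t.IsInert

theorem Label.Holds.isFireball {l : Label} {t : Term Sym} (h : l.Holds t) : t.IsFireball := by
  cases l with
  | val => obtain ⟨b, rfl⟩ := h; exact .value b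
  | inert => exact .inert h

theorem Label.Holds.isValue_iff {l : Label} {t : Term Sym} (h : l.Holds t) :
    t.IsValue ↔ l = .val := by
  cases l with
  | val => exact ⟨fun _ => rfl, fun _ => h⟩
  | inert => exact ⟨fun h' => absurd h' (IsInert.not_hasRedex h).2, fun h' => by cases h'⟩

@[simp] theorem Stack.env_decode (Γ : List ℕ) (σ : ℕ → Term Sym) (π : Stack Sym) :
    (π.decode Γ).env σ = σ := by
  match π with
  | .nil => rfl
  | .cons φ l π => simp only [Stack.decode, Ctx.env_comp, Stack.env_decode Γ σ π, Ctx.env]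

-- Every stack item unfolds to a fireball, so applying an inert to a stack gives an inert, and the
-- context decoding the stack is evaluable. Variables get their shape from the environment.
mutual
theorem ItemOK.holds {E : Env Sym}
    (hE : ∀ x φ l, (x, φ, l) ∈ E → l.Holds (E.values (nameIdx E.names x))) :
    {φ : Item Sym} → {l : Label} → ItemOK E φ l → l.Holds (unfIn E.values (φ.decode E.names))
  | _, _, .lam _ => ⟨_, rfl⟩
  | _, _, .var hx => hE _ _ _ hx
  | _, _, .sym hπ => (hπ.holds hE).1 _ (.sym _)
  | _, _, .inert hx hπ => (hπ.holds hE).1 _ (hE _ _ _ hx)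
theorem StackOK.holds {E : Env Sym}
    (hE : ∀ x φ l, (x, φ, l) ∈ E → l.Holds (E.values (nameIdx E.names x))) :
    {π : Stack Sym} → StackOK E π →
      (∀ A, (unfIn E.values A).IsInert → (unfIn E.values ((π.decode E.names).plug A)).IsInert) ∧
      (π.decode E.names).EvalIn E.values
  | _, .nil => ⟨fun _ h => h, trivial⟩
  | _, .cons hφ hπ => by
    refine ⟨fun A hA => ?_, ?_⟩
    · rw [Stack.decode, Ctx.plug_comp]
      exact (hπ.holds hE).1 _ (.app hA (hφ.holds hE).isFireball)
    · rw [Stack.decode, Ctx.evalIn_comp, Stack.env_decode]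
      exact ⟨(hπ.holds hE).2, trivial, (hφ.holds hE).isFireball⟩
end

theorem Env.values_cons (x : ℕ) (φ : Item Sym) (l : Label) (E : Env Sym) :
    Env.values ((x, φ, l) :: E) = scons (unfIn E.values (φ.decode E.names)) E.values := by
  simp only [Env.values, Env.decode, Ctx.env_comp, Ctx.env]

/-- Distinct names are essential: a name is resolved to its first entry, so a repeated name would
hide an entry with another label. -/
theorem EnvOK.holds {E : Env Sym} (h : EnvOK E) (hn : E.names.Nodup) :
    ∀ x φ l, (x, φ, l) ∈ E → l.Holds (E.values (nameIdx E.names x)) := by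
  induction E with
  | nil => simp
  | cons e E ih =>
    obtain ⟨y, ψ, m⟩ := e
    obtain ⟨hy, hn⟩ := List.nodup_cons.1 hn
    intro x φ l hx
    rw [Env.values_cons]
    simp only [Env.names, List.map_cons, nameIdx_cons]
    rcases List.mem_cons.1 hx with e | hx
    · cases e
      rw [if_pos rfl]
      exact h.1.holds (ih h.2 hn)
    · have : x ≠ y := fun e => hy (e ▸ Env.mem_names hx)
      rw [if_neg this]
      exact ih h.2 hn x φ l hx

theorem EnvOK.evalIn {E : Env Sym} (h : EnvOK E) (hn : E.names.Nodup) :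
    E.decode.EvalIn .var := by
  induction E with
  | nil => trivial
  | cons e E ih =>
    obtain ⟨y, ψ, m⟩ := e
    obtain ⟨hy, hn⟩ := List.nodup_cons.1 hn
    rw [Env.decode, Ctx.evalIn_comp]
    exact ⟨ih h.2 hn, trivial, (h.1.holds (h.2.holds hn)).isFireball⟩

@[simp] theorem Dump.env_decode (Γ : List ℕ) (σ : ℕ → Term Sym) (D : Dump Sym) :
    (Dump.decode Γ D).env σ = σ := by
  induction D with
  | nil => rfl
  | cons d D ih =>
    obtain ⟨t, π⟩ := d
    simp only [Dump.decode, Ctx.env_comp, ih, Stack.env_decode, Ctx.env]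

theorem DumpOK.evalIn {E : Env Sym}
    (hE : ∀ x φ l, (x, φ, l) ∈ E → l.Holds (E.values (nameIdx E.names x))) {D : Dump Sym}
    (h : DumpOK E D) : (Dump.decode E.names D).EvalIn E.values := by
  induction D with
  | nil => trivial
  | cons d D ih =>
    obtain ⟨t, π⟩ := d
    simp only [Dump.decode, Ctx.evalIn_comp, Dump.env_decode]
    exact ⟨ih fun d hd => h d (List.mem_cons_of_mem _ hd),
      ((h _ List.mem_cons_self).2.holds hE).2, trivial⟩

theorem Config.WellNamed.names_nodup {s : Config Sym} (h : s.WellNamed) : s.env.names.Nodup := by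
  have h' : (s.env.flatMap fun e => e.1 :: e.2.1.binders).Nodup := (List.nodup_append.1 h).2.1
  refine List.Nodup.sublist ?_ h'
  generalize s.env = E
  induction E with
  | nil => exact List.Sublist.slnil
  | cons e E ih =>
    simp only [Env.names, List.map_cons, List.flatMap_cons, List.cons_append]
    exact (ih.trans (List.sublist_append_right _ _)).cons_cons _

theorem Config.OK.evalIn_ctx {s : Config Sym} (h : s.OK) (hn : s.env.names.Nodup) :
    s.ctx.EvalIn .var := by
  have hE := h.env.holds hn
  simp only [Config.ctx, Ctx.evalIn_comp]
  refine ⟨h.env.evalIn hn, h.dump.evalIn hE, ?_⟩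
  rw [Dump.env_decode]
  exact (h.stack.holds hE).2

theorem Env.applied_decode (E : Env Sym) (b : Bool) : E.decode.applied b = b := by
  induction E with
  | nil => rfl
  | cons e E ih =>
    obtain ⟨y, ψ, m⟩ := e
    simp only [Env.decode, Ctx.applied_comp, ih, Ctx.applied]

/-- A stack item applies the hole, while with an empty stack a dump entry makes it an argument; the
substitutions of the environment change nothing. -/
theorem Config.applied_ctx (s : Config Sym) : s.ctx.applied false = true ↔ s.stack ≠ .nil := by
  obtain ⟨D, t, π, E⟩ := s
  simp only [Config.ctx, Ctx.applied_comp, Env.applied_decode]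
  cases π with
  | cons φ l π => simp [Stack.decode, Ctx.applied_comp, Ctx.applied]
  | nil =>
    cases D with
    | nil => simp [Stack.decode, Dump.decode, Ctx.applied]
    | cons d D =>
      obtain ⟨w, π⟩ := d
      simp [Stack.decode, Dump.decode, Ctx.applied_comp, Ctx.applied]

theorem Config.OK.useful_iff {s : Config Sym} (h : s.OK) (hn : s.env.names.Nodup) :
    s.ctx.Useful ↔ s.stack ≠ .nil := by
  rw [Ctx.useful_iff, s.applied_ctx]
  exact and_iff_right (h.evalIn_ctx hn)

/-- Usefulness is tested locally by the labels. -/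
theorem Config.OK.useful_and_isValue_iff {s : Config Sym} (h : s.OK) (hn : s.env.names.Nodup)
    {x : ℕ} {φ : Item Sym} {l : Label} {E₁ E₂ : Env Sym} (hE : s.env = E₁ ++ (x, φ, l) :: E₂) :
    (s.ctx.Useful ∧ (Ctx.relUnf (φ.decode E₂.names) E₂.decode).IsValue) ↔
      l = .val ∧ s.stack ≠ .nil := by
  have hok := h.env
  rw [hE] at hok
  have hn₂ : (Env.names ((x, φ, l) :: E₂)).Nodup := by
    rw [hE, Env.names, List.map_append] at hn
    exact (List.nodup_append.1 hn).2.1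
  have hok₂ := hok.of_append
  have hh := hok₂.1.holds (hok₂.2.holds (List.nodup_cons.1 hn₂).2)
  rw [h.useful_iff hn, Ctx.relUnf_eq, ← Env.values, hh.isValue_iff, and_comm]

/-! ## Decoding of the transitions -/

/-- The focus moves inside one and the same term, so the decodings are equal, not just equivalent.
-/
theorem Trans.decode_eq {l : Tr} {s s' : Config Sym} (h : Trans l s s')
    (hl : l.kind = .commutative) : s.decode = s'.decode := by
  cases h <;> first
    | (cases hl; done)
    | simp only [Config.decode, Config.ctx, Dump.decode, Stack.decode, Item.decode, Ctx.plug_comp,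
        Ctx.plug, Code.toTerm]

-- Decodings of stacks bind nothing, so changing the scope renames them uniformly. This serves when
-- `um` adds a name to the environment.
mutual
theorem ItemOK.decode_rename {E : Env Sym} {Γ : List ℕ} {ρ : ℕ → ℕ}
    (h : ∀ x ∈ E.names, nameIdx Γ x = ρ (nameIdx E.names x)) : {φ : Item Sym} → {l : Label} →
      ItemOK E φ l → φ.decode Γ = (φ.decode E.names).rename ρ
  | _, _, .lam hs => Code.toTerm_rename fun x hx => h x (hs x hx)
  | _, _, .var hx => by
    simp only [Item.decode, Code.toTerm_var, h _ (Env.mem_names hx)]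
    rfl
  | _, _, .sym hπ => by
    simp only [Item.decode, (hπ.decode_rename h).1, Ctx.plug_rename, (hπ.decode_rename h).2]
    rfl
  | _, _, .inert hx hπ => by
    simp only [Item.decode, (hπ.decode_rename h).1, Ctx.plug_rename, (hπ.decode_rename h).2,
      Code.toTerm_var, h _ (Env.mem_names hx)]
    rfl
theorem StackOK.decode_rename {E : Env Sym} {Γ : List ℕ} {ρ : ℕ → ℕ}
    (h : ∀ x ∈ E.names, nameIdx Γ x = ρ (nameIdx E.names x)) : {π : Stack Sym} → StackOK E π →
      π.decode Γ = (π.decode E.names).rename ρ ∧ (π.decode E.names).depth = 0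
  | _, .nil => ⟨rfl, rfl⟩
  | _, .cons hφ hπ => by
    simp only [Stack.decode, (hπ.decode_rename h).1, Ctx.rename_comp, (hπ.decode_rename h).2,
      hφ.decode_rename h, Ctx.depth_comp]
    exact ⟨rfl, rfl⟩
end

theorem DumpOK.decode_rename {E : Env Sym} {Γ : List ℕ} {ρ : ℕ → ℕ}
    (h : ∀ x ∈ E.names, nameIdx Γ x = ρ (nameIdx E.names x)) {D : Dump Sym} (hD : DumpOK E D) :
      Dump.decode Γ D = (Dump.decode E.names D).rename ρ ∧ (Dump.decode E.names D).depth = 0 := by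
  induction D with
  | nil => exact ⟨rfl, rfl⟩
  | cons d D ih =>
    obtain ⟨t, π⟩ := d
    have ih' := ih fun d hd => hD d (List.mem_cons_of_mem _ hd)
    obtain ⟨ht, hπ⟩ := hD _ List.mem_cons_self
    have hπ' := hπ.decode_rename h
    have ht' := Code.toTerm_rename (Γ := E.names) (Γ' := Γ) (ρ := ρ) fun x hx => h x (ht x hx)
    simp only [Dump.decode, Ctx.depth_comp, Ctx.rename_comp, ih'.1, ih'.2, hπ'.1, hπ'.2, ht']
    exact ⟨rfl, rfl⟩

theorem StructEq.plug {t w : Term Sym} (h : StructEq t w) (S : Ctx Sym) :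
    StructEq (S.plug t) (S.plug w) := by
  induction S with
  | hole => exact h
  | appR t S ih => exact .appR _ ih
  | appL S t ih => exact .appL _ ih
  | es S t ih => exact .esL _ ih

/-- Explicit substitutions move out of applicative contexts. -/
theorem structEq_plug_es {S : Ctx Sym} (hS : S.depth = 0) (t w : Term Sym) :
    StructEq (S.plug (.es t w)) (.es ((S.rename (· + 1)).plug t) w) := by
  induction S with
  | hole => exact .refl _
  | appR r S ih => exact (StructEq.appR _ (ih hS)).trans (.symm (.atR _ _ _))
  | appL S r ih => exact (StructEq.appL _ (ih hS)).trans (.symm (.atL _ _ _))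
  | es S r ih => simp [Ctx.depth] at hS

/-- The calculus leaves the new substitution at the place of the redex, whereas the machine stores
it in the environment. Structural equivalence extrudes it from stack and dump, whose terms do not
mention the new name. -/
theorem Trans.um_decode {s s' : Config Sym} (hs : s.OK) (hn : s.env.names.Nodup)
    (hn' : s'.env.names.Nodup) (h : Trans .um s s') :
    ∃ t, UStep .mul s.decode t ∧ StructEq t s'.decode := by
  cases h with
  | um D x t φ l π E =>
    have hev := hs.evalIn_ctx hn
    have hx : x ∉ E.names := (List.nodup_cons.1 hn').1
    have hidx : ∀ y ∈ E.names, nameIdx (x :: E.names) y = nameIdx E.names y + 1 := by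
      intro y hy
      rw [nameIdx_cons, if_neg (fun e : y = x => hx (e ▸ hy))]
    cases hs.stack with | cons hφ hπ => ?_
    obtain ⟨hD1, hD2⟩ := DumpOK.decode_rename (ρ := (· + 1)) hidx hs.dump
    obtain ⟨hπ1, hπ2⟩ := hπ.decode_rename (ρ := (· + 1)) hidx
    have h1 : (⟨D, .lam x t, .cons φ l π, E⟩ : Config Sym).ctx
        = (E.decode.comp ((Dump.decode E.names D).comp (π.decode E.names))).comp
          (.appL .hole (φ.decode E.names)) := by
      simp only [Config.ctx, Stack.decode, Ctx.comp_assoc]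
    have hu := UStep.um (E.decode.comp ((Dump.decode E.names D).comp (π.decode E.names))) .hole
      (t.toTerm (x :: E.names)) (φ.decode E.names) trivial
      (by
        rw [← h1, Ctx.useful_iff, Config.applied_ctx]
        exact ⟨hev, by simp⟩)
    refine ⟨_, by simpa only [Config.decode, h1, Ctx.plug_comp, Ctx.plug, Code.toTerm] using hu, ?_⟩
    simp only [Config.decode, Config.ctx, Ctx.plug_comp, Env.decode]
    refine StructEq.plug ?_ _
    have h2 := structEq_plug_es (S := (Dump.decode E.names D).comp (π.decode E.names))
      (by simp only [Ctx.depth_comp, hD2, hπ2]) (t.toTerm (x :: E.names)) (φ.decode E.names)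
    rw [Ctx.rename_comp, hD2, Ctx.plug_comp, Ctx.plug_comp] at h2
    simp only [Ctx.plug, Ctx.depth, shift_zero]
    refine h2.trans (.of_eq ?_)
    simp only [Env.names, List.map_cons] at hD1 hπ1 ⊢
    rw [hD1, hπ1]
    rfl

theorem Env.decode_append (E₁ E₂ : Env Sym) :
    ∃ C : Ctx Sym, Env.decode (E₁ ++ E₂) = E₂.decode.comp C ∧ C.depth = E₁.length := by
  induction E₁ with
  | nil => exact ⟨.hole, by simp, rfl⟩
  | cons e E₁ ih =>
    obtain ⟨y, ψ, m⟩ := e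
    obtain ⟨C, hC, hd⟩ := ih
    refine ⟨C.comp (.es .hole (ψ.decode (Env.names (E₁ ++ E₂)))), ?_, ?_⟩
    · rw [List.cons_append, Env.decode, hC, Ctx.comp_assoc]
    · simp [Ctx.depth_comp, hd, Ctx.depth]

theorem Stack.depth_decode (Γ : List ℕ) (π : Stack Sym) : (π.decode Γ).depth = 0 := by
  match π with
  | .nil => rfl
  | .cons φ l π => simp only [Stack.decode, Ctx.depth_comp, Stack.depth_decode Γ π, Ctx.depth]

theorem Dump.depth_decode (Γ : List ℕ) (D : Dump Sym) : (Dump.decode Γ D).depth = 0 := by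
  induction D with
  | nil => rfl
  | cons d D ih => simp only [Dump.decode, Ctx.depth_comp, ih, Stack.depth_decode, Ctx.depth]

/-- The stored code is not an explicit substitution, so the rule applies with `L` empty. The outer
context decodes the entries after `x`, and `S'` all that lies in the scope of `x`. -/
theorem Trans.ue_decode {s s' : Config Sym} (hs : s.OK) (hn : s.env.names.Nodup)
    (h : Trans .ue s s') : UStep .exp s.decode s'.decode := by
  cases h with
  | ue D x w w' φ l π E₁ E₂ hw =>
    have huv := (hs.useful_and_isValue_iff hn rfl).2 ⟨rfl, by simp⟩
    obtain ⟨hu, hv⟩ := huv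
    have hok := hs.env.of_append
    have hnames : Env.names (E₁ ++ (x, .code w, .val) :: E₂) = (E₁.names ++ [x]) ++ E₂.names := by
      simp [Env.names]
    obtain ⟨C, hC, hd⟩ := Env.decode_append E₁ ((x, .code w, .val) :: E₂)
    set Γ := Env.names (E₁ ++ (x, .code w, .val) :: E₂) with hΓ
    have hctx : ∀ c : Code Sym,
        (⟨D, c, .cons φ l π, E₁ ++ (x, .code w, .val) :: E₂⟩ : Config Sym).ctx
        = E₂.decode.comp (.es (C.comp ((Dump.decode Γ D).comp ((Stack.cons φ l π).decode Γ)))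
            (w.toTerm E₂.names)) := by
      intro c
      simp only [Config.ctx, hC, Env.decode, Ctx.comp_assoc, ← hΓ]
      rfl
    have hlen : (C.comp ((Dump.decode Γ D).comp ((Stack.cons φ l π).decode Γ))).depth
        = E₁.length := by
      rw [Ctx.depth_comp, Ctx.depth_comp, hd, Dump.depth_decode, Stack.depth_decode]
      rfl
    have hdisj : ∀ y ∈ E₂.names, y ∉ E₁.names ++ [x] := by
      intro y hy hy'
      rw [hnames] at hn
      exact (List.nodup_append.1 hn).2.2 y hy' y hy rfl
    have hx : nameIdx Γ x = E₁.length := by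
      have : x ∉ E₁.names := by
        intro hx
        rw [hnames, List.append_assoc] at hn
        exact (List.nodup_append.1 hn).2.2 x hx x (by simp) rfl
      rw [hnames, List.append_assoc, nameIdx_append this]
      simp [nameIdx_cons, Env.names]
    -- The copy is read below `E₁.length + 1` further binders, those of `E₁` and `x`, none of which
    -- has a name free in `w`.
    have hw' : w'.toTerm Γ = (w.toTerm E₂.names).shift (E₁.length + 1) := by
      rw [← hw.toTerm_eq, hnames]
      refine Code.toTerm_rename fun y hy => ?_
      rw [nameIdx_append (hdisj y (hok.1.code_scoped y hy))]
      simp [Env.names]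
    have := UStep.ue E₂.decode
      (C.comp ((Dump.decode Γ D).comp ((Stack.cons φ l π).decode Γ))) .hole (w.toTerm E₂.names)
      trivial (by rw [Ctx.plug, ← hctx (.var x)]; exact hu) (w.toTerm_ne_es _)
      (by rwa [Ctx.comp_hole])
    simp only [Ctx.depth, Nat.add_zero, upr_id, Ctx.rename_id, hlen, ← hw', Ctx.plug] at this
    simp only [Config.decode, hctx, Ctx.plug_comp, ← hΓ, Code.toTerm_var, hx, Ctx.plug] at this ⊢
    exact this

/-! ## Determinism, progress and termination of the machine -/

theorem Env.entry_unique {E : Env Sym} (hn : E.names.Nodup) {x : ℕ} {e e' : Item Sym × Label}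
    (h : (x, e) ∈ E) (h' : (x, e') ∈ E) : e = e' := by
  have := List.inj_on_of_nodup_map hn h h' rfl
  exact (Prod.mk.inj this).2

theorem Trans.deterministic {l₁ l₂ : Tr} {s s₁ s₂ : Config Sym} (hn : s.env.names.Nodup)
    (h₁ : Trans l₁ s s₁) (h₂ : Trans l₂ s s₂) :
    l₁ = l₂ ∧ s₁.dump = s₂.dump ∧ s₁.code.AlphaEq s₂.code ∧ s₁.stack = s₂.stack ∧
      s₁.env = s₂.env := by
  obtain ⟨D, c, π, E⟩ := s
  -- The overlaps on variables with a common stack are settled by the entry of `x`, which is unique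
  -- because names are distinct.
  have key : ∀ {x : ℕ} {φ φ' : Item Sym} {l l' : Label} {E₁ E₂ E₁' E₂' : Env Sym},
      E = E₁ ++ (x, φ, l) :: E₂ → E = E₁' ++ (x, φ', l') :: E₂' → φ = φ' ∧ l = l' := by
    intro x φ φ' l l' E₁ E₂ E₁' E₂' e e'
    have := Env.entry_unique hn (x := x) (e := (φ, l)) (e' := (φ', l')) (by simp [e]) (by simp [e'])
    exact Prod.mk.inj this
  generalize hs : (⟨D, c, π, E⟩ : Config Sym) = s at h₁ h₂
  cases h₁ <;> cases hs <;> generalize hs' : Config.mk _ _ _ _ = s' at h₂ <;> cases h₂ <;>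
    simp only [Config.mk.injEq, List.cons.injEq, Prod.mk.injEq, reduceCtorEq, Code.app.injEq,
      Code.lam.injEq, Code.sym.injEq, Code.var.injEq, Stack.cons.injEq, false_and, and_false]
      at hs'
  · simp [hs', Code.AlphaEq]
  · simp [hs', Code.AlphaEq]
  · simp [hs', Code.AlphaEq]
  · simp [hs', Code.AlphaEq]
  · obtain ⟨⟨⟨rfl, rfl⟩, rfl⟩, rfl, hπ, e⟩ := hs'
    simp [e, hπ, Code.AlphaEq]
  · obtain ⟨-, rfl, -, e⟩ := hs'
    exact absurd (key rfl e).2 (by simp)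
  · obtain ⟨-, rfl, -, e⟩ := hs'
    exact absurd (key rfl e).2 (by simp)
  · obtain ⟨-, rfl, -, e⟩ := hs'
    exact absurd (key rfl e).2 (by simp)
  · obtain ⟨⟨⟨rfl, rfl⟩, rfl⟩, rfl, -, e⟩ := hs'
    simp [e, Code.AlphaEq]
  · obtain ⟨-, rfl, -, e⟩ := hs'
    exact absurd (key rfl e).2 (by simp)
  · rename_i ha _ _ _ _ _ _ _ _ _ ha'
    obtain ⟨rfl, rfl, ⟨rfl, rfl, rfl⟩, e⟩ := hs'
    have hw := (key rfl e).1
    cases hw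
    exact ⟨rfl, rfl, Eq.trans (Eq.symm ha) ha', rfl, e⟩

/-- The size of a code. -/
def Code.size : Code Sym → ℕ
  | .var _ => 1
  | .sym _ => 1
  | .lam _ t => t.size + 1
  | .app t w => t.size + w.size + 1

/-- The measure that decreases along commutative transitions. -/
def Config.size (s : Config Sym) : ℕ := s.code.size + (s.dump.map fun d => d.1.size).sum

/-- `c1` distributes an application over code and dump and loses its node; the others discard the
current code and resume one from the dump. Stacks do not count. -/
theorem Trans.size_lt {l : Tr} {s s' : Config Sym} (h : Trans l s s')
    (hl : l.kind = .commutative) : s'.size < s.size := by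
  cases h <;> first
    | (cases hl; done)
    | simp only [Config.size, List.map_cons, List.sum_cons, Code.size]; omega

/-- All transitions but `ue` merely permute the list of bound names. -/
theorem Trans.wellNamed {l : Tr} {s s' : Config Sym} (h : Trans l s s') (hl : l ≠ .ue)
    (hs : s.WellNamed) : s'.WellNamed := by
  refine List.Perm.nodup (List.perm_iff_count.2 fun a => ?_) hs
  cases h <;> first
    | exact absurd rfl hl
    | simp only [Config.binders, List.flatMap_cons, Code.binders, Stack.binders, Item.binders,
        List.count_append, List.count_cons, List.count_nil]; omega

/-- A well-named configuration where a value variable is applied has a transition. -/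
theorem exists_trans_ue {D : Dump Sym} {x : ℕ} {w : Code Sym} {φ : Item Sym} {l : Label}
    {π : Stack Sym} {E₁ E₂ : Env Sym}
    (hs : (⟨D, .var x, .cons φ l π, E₁ ++ (x, .code w, .val) :: E₂⟩ : Config Sym).WellNamed) :
    ∃ s' : Config Sym, s'.WellNamed ∧
      Trans .ue ⟨D, .var x, .cons φ l π, E₁ ++ (x, .code w, .val) :: E₂⟩ s' := by
  set s : Config Sym := ⟨D, .var x, .cons φ l π, E₁ ++ (x, .code w, .val) :: E₂⟩ with hsd
  -- A number above the sum of all bound names exceeds each of them.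
  obtain ⟨w', hw, hnd, hb⟩ := exists_alphaEq_fresh w (s.binders.sum + 1)
  refine ⟨⟨D, w', .cons φ l π, E₁ ++ (x, .code w, .val) :: E₂⟩, ?_, .ue D x w w' φ l π E₁ E₂ hw⟩
  have hdisj : (w'.binders ++ s.binders).Nodup := by
    refine List.Nodup.append hnd hs fun b h h' => ?_
    have := hb b h
    have := List.single_le_sum (fun _ _ => Nat.zero_le _) b h'
    omega
  refine List.Perm.nodup (List.perm_iff_count.2 fun a => ?_) hdisj
  simp only [hsd, Config.binders, List.count_append, Code.binders, List.count_nil]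
  omega

/-- The environment decodes to a substitution context, so unfolding the state is unfolding its
applied code in the environment. -/
theorem Config.isFireball_decode_of_nil_dump {s : Config Sym} (hD : s.dump = [])
    (hf : (unfIn s.env.values
      ((s.stack.decode s.env.names).plug (s.code.toTerm s.env.names))).IsFireball) :
    s.decode.unf.IsFireball := by
  have hL : ∀ E : Env Sym, E.decode.IsSubst := by
    intro E
    induction E with
    | nil => trivial
    | cons e E ih =>
      obtain ⟨y, ψ, m⟩ := e
      exact Ctx.IsSubst.comp ih (by trivial)
  rw [← unfIn_var_env, Config.decode, Config.ctx, hD, Ctx.plug_comp,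
    Ctx.unfIn_plug_of_isSubst (hL _)]
  exact hf

theorem Config.OK.progress {s : Config Sym} (h : s.OK) (hs : s.WellNamed)
    (hr : ∃ k t, UStep k s.decode t) : ∃ l s', s'.WellNamed ∧ Trans l s s' := by
  have hn := hs.names_nodup
  have hE := h.env.holds hn
  -- Each stuck configuration below has an empty dump and unfolds to a fireball, which contradicts
  -- reducibility of its decoding.
  have hfin : s.dump = [] → (unfIn s.env.values
      ((s.stack.decode s.env.names).plug (s.code.toTerm s.env.names))).IsFireball → False := by
    intro hD hf
    obtain ⟨k, t, ht⟩ := hr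
    exact ht.not_isFireball (Config.isFireball_decode_of_nil_dump hD hf)
  have fwd : ∀ {l s'}, l ≠ .ue → Trans l s s' → ∃ l s', s'.WellNamed ∧ Trans l s s' :=
    fun hl ht => ⟨_, _, ht.wellNamed hl hs, ht⟩
  obtain ⟨D, c, π, E⟩ := s
  cases c with
  | app t w => exact fwd (by simp) (.c1 D t w π E)
  | lam x t =>
    cases π with
    | cons φ l π => exact fwd (by simp) (.um D x t φ l π E)
    | nil =>
      cases D with
      | cons d D => exact fwd (by simp) (.c2 D d.1 d.2 x t E)
      | nil => exact (hfin rfl (.value _)).elim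
  | sym a =>
    cases D with
    | cons d D => exact fwd (by simp) (.c3 D d.1 d.2 a π E)
    | nil => exact (hfin rfl (.inert ((h.stack.holds hE).1 _ (.sym a)))).elim
  | var x =>
    obtain ⟨⟨y, φ, l⟩, he, rfl⟩ := List.mem_map.1 (h.code x rfl)
    have hx := hE y φ l he
    obtain ⟨E₁, E₂, rfl⟩ := List.append_of_mem he
    cases l with
    | inert =>
      cases D with
      | cons d D => exact fwd (by simp) (.c4 D d.1 d.2 y π φ E₁ E₂)
      | nil => exact (hfin rfl (.inert ((h.stack.holds hE).1 _ hx))).elim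
    | val =>
      have hφ := h.env.of_append.1
      obtain ⟨w, rfl⟩ : ∃ w, φ = .code w := by
        cases hφ with
        | lam _ => exact ⟨_, rfl⟩
        | var _ => exact ⟨_, rfl⟩
      cases π with
      | cons φ l π =>
        obtain ⟨s', hs', ht⟩ := exists_trans_ue hs
        exact ⟨_, s', hs', ht⟩
      | nil =>
        cases D with
        | cons d D => exact fwd (by simp) (.c5 D d.1 d.2 y w E₁ E₂)
        | nil => exact (hfin rfl hx.isFireball).elim

-- Reachability and assembly of the distillery

theorem Config.OK.of_reachable {s : State Sym} (h : (glamour Sym).Reachable s) : s.1.OK := by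
  obtain ⟨s₀, ⟨t, ht, hs₀⟩, hr⟩ := h
  induction hr with
  | refl =>
    rw [hs₀]
    exact ⟨trivial, fun _ h => (by cases h), (Code.closedAt_toTerm_iff [] t).1 ht, .nil⟩
  | tail _ hst ih =>
    obtain ⟨l, hl⟩ := hst
    exact ih.trans hl

theorem wellFormed_of_termReachable {t : Term Sym} (h : (glamour Sym).TermReachable t) :
    WellFormed .var t := by
  obtain ⟨t₀, ht₀, hr⟩ := h
  induction hr with
  | refl => exact ESFree.wellFormed ht₀.2 _
  | tail _ hst ih =>
    rcases hst with ⟨k, hk⟩ | he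
    · exact ih.uStep hk
    · exact (StructEq.wellFormed_iff he _).1 ih

theorem glamour_isExplicit : (glamour Sym).IsExplicit := by
  intro l k s s' hr hk ht
  have hs := Config.OK.of_reachable hr
  have hn := s.2.names_nodup
  cases l with
  | um =>
    cases hk
    exact Trans.um_decode hs hn s'.2.names_nodup ht
  | ue =>
    cases hk
    exact ⟨_, Trans.ue_decode hs hn ht, .refl _⟩
  | _ => cases hk

theorem glamour_isDistillery : (glamour Sym).IsDistillery where
  machine_det _ _ s _ _ h₁ h₂ := Trans.deterministic s.2.names_nodup h₁ h₂
  initial_closed := by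
    rintro ⟨s, hs⟩ ⟨t, ht, rfl⟩
    exact ⟨ht, t.toTerm_esFree []⟩
  initial_inj := by
    rintro ⟨s, hs⟩ ⟨s', hs'⟩ ⟨t, ht, rfl⟩ ⟨t', ht', rfl⟩ h
    exact ⟨rfl, h, rfl, rfl⟩
  initial_surj := by
    rintro t ⟨hcl, hes⟩
    obtain ⟨c, -, -, rfl, hnd, -⟩ := exists_code_toTerm (n₀ := 0) hes (Γ := []) (n := 0) le_rfl
      List.nodup_nil (by simp) hcl
    refine ⟨⟨⟨[], c, .nil, []⟩, ?_⟩, ⟨c, hcl, rfl⟩, rfl⟩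
    simpa [Config.WellNamed, Config.binders, Stack.binders] using hnd
  strategy_det _ _ _ _ _ h₁ h₂ := UStep.deterministic h₁ h₂
  equiv_equivalence := ⟨.refl, .symm, .trans⟩
  bisim _ _ _ _ hr he hk := StructEq.bisimulation (wellFormed_of_termReachable hr) he hk
  principal l k s s' hr hk ht := ⟨k, glamour_isExplicit l k s s' hr hk ht⟩
  commutative _ _ _ _ hk ht := .of_eq (Trans.decode_eq ht hk)

theorem glamour_isReflective : (glamour Sym).IsReflective where
  termination := by
    rintro s - ⟨f, -, hf⟩
    have : ∀ n, (f n).1.size + n ≤ (f 0).1.size := by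
      intro n
      induction n with
      | zero => exact le_rfl
      | succ n ih =>
        obtain ⟨l, hl, ht⟩ := hf n
        have := Trans.size_lt ht hl
        omega
    have := this ((f 0).1.size + 1)
    omega
  progress s hr h := by
    obtain ⟨l, s', hs', ht⟩ := (Config.OK.of_reachable hr).progress s.2 h
    exact ⟨l, ⟨s', hs'⟩, ht⟩

end Glamour

open Glamour in
theorem mainTheorem5 (Sym : Type u) :
    (glamour Sym).IsDistillery ∧ (glamour Sym).IsReflective ∧ (glamour Sym).IsExplicit ∧
    ∀ s : State Sym, (glamour Sym).Reachable s →
      (∀ (l : Tr) (s' : State Sym), Tr.kind l = .commutative → Trans l s.1 s'.1 → s.1.decode = s'.1.decode) ∧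
      (∀ s' : State Sym, Trans .um s.1 s'.1 →
        ∃ t, UStep .mul s.1.decode t ∧ StructEq t s'.1.decode) ∧
      (∀ s' : State Sym, Trans .ue s.1 s'.1 → UStep .exp s.1.decode s'.1.decode) ∧
      (∀ (x : ℕ) (φ : Item Sym) (l : Label) (E₁ E₂ : Env Sym),
        s.1.code = .var x → s.1.env = E₁ ++ (x, φ, l) :: E₂ →
        ((s.1.ctx.Useful ∧
            (Ctx.relUnf (φ.decode (Env.names E₂)) (Env.decode E₂)).IsValue) ↔
          l = .val ∧ s.1.stack ≠ .nil)) := by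
  refine ⟨glamour_isDistillery, glamour_isReflective, glamour_isExplicit, fun s hr => ?_⟩
  have hs := Config.OK.of_reachable hr
  have hn := s.2.names_nodup
  exact ⟨fun l s' hl ht => ht.decode_eq hl,
    fun s' ht => ht.um_decode hs hn s'.2.names_nodup,
    fun s' ht => ht.ue_decode hs hn,
    fun x φ l E₁ E₂ _ hE => hs.useful_and_isValue_iff hn hE⟩
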